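/- **Theorem.** Let $k$ be a field, $d\ge 0$, and let $X_1, X_2 \subseteq \mathbb{R}^d$ be finite sets. *Notation.* For a finite set $X$ in a Euclidean space $\mathbb{R}^m$ and $x\in X$ let $\mathrm{Vor}(X,x)=\{p : d(x,p)\le d(y,p)\ \text{for all } y\in X\}$, and let $\mathrm{Del}(X)$ be the simplicial complex of all nonempty $\sigma\subseteq X$ with $\bigcap_{x\in\sigma}\mathrm{Vor}(X,x)\neq\emptyset$. Call $\varepsilon>0$ *admissible* for $X$ if $2\varepsilon<\inf_{p}\max_{x\in\sigma} d(p,\mathrm{Vor}(X,x))$ for every nonempty $\sigma\subseteq X$ with $\sigma\notin\mathrm{Del}(X)$, and put $\mathrm{Del}^X_\varepsilon(x,p)=h_\varepsilon(d(p,\mathrm{Vor}(X,x)))$, where $h_\varepsilon(t)=-\ln(1-t/\varepsilon)$ for $t<\varepsilon$ and $h_\varepsilon(t)=\infty$ for $t\ge\varepsilon$. The nerve $N\Lambda_t$, $t>0$, of a function $\Lambda\colon V\times Y\to[0,\infty]$ consists of the nonempty finite $\sigma\subseteq V$ for which there is $y\in Y$ with $\Lambda(v,y)<t$ for all $v\in\sigma$.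 The alpha complex of $X$ (with an admissible parameter $\varepsilon$) is the nerve of $A^X(x,p)=\max(d(x,p),\mathrm{Del}^X_\varepsilon(x,p))$, $x \in X$, $p \in \mathbb{R}^m$; the filtration value of a simplex is the infimum of the $t>0$ at which it is present. Let $s_i$ be larger than all filtration values of the alpha complex of $X_i$ (taken with some admissible parameter $\varepsilon_i$ for $X_i$), $i=1,2$, and let $s>0$ with $s>\max(s_1,s_2)$. Let $Z=X_1\times\{s\}\cup X_2\times\{-s\}\subseteq\mathbb{R}^{d+1}$, let $\mathrm{pr}\colon\mathbb{R}^{d+1}\to\mathbb{R}^d$ omit the last coordinate, let $\varepsilon$ be admissible for $Z$, and let $$D\colon Z\times(\mathbb{R}^d\times\mathbb{R}^{d+1})\to[0,\infty],\qquad D(z,(p,q))=\max\bigl(d(\mathrm{pr}(z),p),\,\mathrm{Del}^Z_\varepsilon(z,q)\bigr).$$ With $j_1\colon X_1\to Z$, $j_1(x)=(x,s)$, let $K_t=j_1(\mathrm{Del}(X_1))\cup ND_t$ for $t>0$; this is the relative Delaunay–Čech complex $\mathrm{Del\check{C}}(X_1\cup X_2,X_1)_t$. Let $X^t=\bigcup_{x\in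 X}\{p\in\mathbb{R}^d : d(x,p)<t\}$. *Claim.* If $X_1\ne\emptyset$, then for every $n\ge 0$ there is an isomorphism of persistence modules $$\bigl(\tilde H_n(K_t;k)\bigr)_{t>0}\;\cong\;\bigl(H_n((X_1\cup X_2)^t,X_1^t;k)\bigr)_{t>0},$$ where $\tilde H$ denotes reduced simplicial homology and the right hand side is relative singular homology. If $X_1=\emptyset$, the same holds with $\tilde H_n(K_t;k)$ replaced by the unreduced homology $H_n(K_t;k)$. -/

import Mathlib

open CategoryTheory CategoryTheory.Limits
open scoped ENNReal

noncomputable section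

namespace RelDelCech

/-! ### Filtered simplicial complexes and Dowker nerves -/

/-- A filtered simplicial complex on the vertex set `V`: simplicial complexes `K t`, `t > 0`, with
`K s ≤ K t` for `s ≤ t`. Simplices are nonempty finite sets. -/
abbrev FilteredComplex (V : Type) : Type :=
  Set.Ioi (0 : ℝ) →o PreAbstractSimplicialComplex V

/-- The Dowker nerve of `Λ : X × Y → [0, ∞]`: at level `t` its simplices are the nonempty finite
subsets `σ` of `X` for which there is `y` with `Λ (x, y) < t` for every `x ∈ σ`. -/
def dowkerNerve {X Y : Type} (Λ : X → Y → ℝ≥0∞) : FilteredComplex X where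
  toFun t :=
    { faces := {σ | σ.Nonempty ∧ ∃ y, ∀ x ∈ σ, Λ x y < ENNReal.ofReal t}
      isRelLowerSet_faces := by
        rintro σ ⟨hσ, y, hy⟩
        exact ⟨hσ, fun τ hτσ hτ => ⟨hτ, y, fun x hx => hy x (hτσ hx)⟩⟩ }
  monotone' := by
    rintro a b hab σ ⟨hσ, y, hy⟩
    exact ⟨hσ, y, fun x hx => (hy x hx).trans_le (ENNReal.ofReal_le_ofReal hab)⟩

/-- The filtration value of a simplex: the infimum of the `t > 0` at which it is present. -/
def filtrationValue {V : Type} (K : FilteredComplex V) (σ : Finset V) : ℝ :=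
  sInf (Subtype.val '' {t | σ ∈ K t})

/-! ### Voronoi cells, Delaunay complexes and the associated dissimilarities -/

section Voronoi

variable {d : ℕ}

/-- The Voronoi cell of `x` with respect to `X`. -/
def vor (X : Set (EuclideanSpace ℝ (Fin d))) (x : EuclideanSpace ℝ (Fin d)) :
    Set (EuclideanSpace ℝ (Fin d)) :=
  {p | ∀ y ∈ X, dist x p ≤ dist y p}

/-- The Delaunay complex of `X`. -/
def delaunayComplex (X : Set (EuclideanSpace ℝ (Fin d))) : PreAbstractSimplicialComplex X where
  faces := {σ | σ.Nonempty ∧ ∃ p, ∀ x ∈ σ, p ∈ vor X x}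
  isRelLowerSet_faces := by
    rintro σ ⟨hσ, p, hp⟩
    exact ⟨hσ, fun τ hτσ hτ => ⟨hτ, p, fun x hx => hp x (hτσ hx)⟩⟩

/-- The function `p ↦ max {d(p, Vor(X, x)) | x ∈ σ}`. -/
def dVor (X : Set (EuclideanSpace ℝ (Fin d))) (p : EuclideanSpace ℝ (Fin d)) (σ : Finset X) :
    ℝ≥0∞ :=
  ⨆ x ∈ σ, Metric.infEDist p (vor X x)

/-- `ε` is an admissible thickening parameter for `X`: it is positive, and `2 ε < ε_σ` for every
nonempty subset `σ` of `X` that is not a Delaunay simplex, where `ε_σ = inf_p dVor(p, σ)`. -/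
def IsAdmissible (X : Set (EuclideanSpace ℝ (Fin d))) (ε : ℝ) : Prop :=
  0 < ε ∧ ∀ σ : Finset X, σ.Nonempty → σ ∉ delaunayComplex X →
    2 * ENNReal.ofReal ε < ⨅ p, dVor X p σ

/-- The order preserving map `h : [0, ∞] → [0, ∞]`, `h(t) = - ln (1 - t / ε)` for `t < ε` and
`h(t) = ∞` for `t ≥ ε`. -/
def hMap (ε : ℝ) (t : ℝ≥0∞) : ℝ≥0∞ :=
  open Classical in
  if t < ENNReal.ofReal ε then ENNReal.ofReal (-Real.log (1 - t.toReal / ε)) else ∞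

/-- The (continuous) Delaunay dissimilarity `X × ℝᵈ → [0, ∞]`. -/
def delaunayDissim (ε : ℝ) (X : Set (EuclideanSpace ℝ (Fin d)))
    (x : X) (p : EuclideanSpace ℝ (Fin d)) : ℝ≥0∞ :=
  hMap ε (Metric.infEDist p (vor X x))

/-- The alpha dissimilarity `X × ℝᵈ → [0, ∞]`. -/
def alphaDissim (ε : ℝ) (X : Set (EuclideanSpace ℝ (Fin d)))
    (x : X) (p : EuclideanSpace ℝ (Fin d)) : ℝ≥0∞ :=
  max (delaunayDissim ε X x p) (edist (x : EuclideanSpace ℝ (Fin d)) p)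

/-- The alpha complex of `X`. -/
def alphaComplex (ε : ℝ) (X : Set (EuclideanSpace ℝ (Fin d))) : FilteredComplex X :=
  dowkerNerve (alphaDissim ε X)

/-! ### The relative Delaunay–Čech complex -/

/-- The point `(x, a)` of `ℝᵈ⁺¹`. -/
def lift (a : ℝ) (x : EuclideanSpace ℝ (Fin d)) : EuclideanSpace ℝ (Fin (d + 1)) :=
  WithLp.toLp 2 (Fin.snoc (α := fun _ => ℝ) x.ofLp a)

/-- The projection `ℝᵈ⁺¹ → ℝᵈ` omitting the last coordinate. -/
def pr (z : EuclideanSpace ℝ (Fin (d + 1))) : EuclideanSpace ℝ (Fin d) :=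
  WithLp.toLp 2 (fun i => z i.castSucc)

/-- `Z = X₁ × {s} ∪ X₂ × {-s}`. -/
def liftedPair (X₁ X₂ : Set (EuclideanSpace ℝ (Fin d))) (s : ℝ) :
    Set (EuclideanSpace ℝ (Fin (d + 1))) :=
  lift s '' X₁ ∪ lift (-s) '' X₂

/-- The dissimilarity `D(z, (p, q)) = max(d(pr z, p), Del^Z(z, q))` on `Z × (ℝᵈ × ℝᵈ⁺¹)`. -/
def liftedDissim (X₁ X₂ : Set (EuclideanSpace ℝ (Fin d))) (s ε : ℝ) (z : liftedPair X₁ X₂ s)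
    (y : EuclideanSpace ℝ (Fin d) × EuclideanSpace ℝ (Fin (d + 1))) : ℝ≥0∞ :=
  max (edist (pr z) y.1) (delaunayDissim ε (liftedPair X₁ X₂ s) z y.2)

/-- The map `j₁ : X₁ → Z`, `x ↦ (x, s)`, on vertices. -/
def j₁ (X₁ X₂ : Set (EuclideanSpace ℝ (Fin d))) (s : ℝ) (x : X₁) : liftedPair X₁ X₂ s :=
  ⟨lift s x, Or.inl ⟨x, x.2, rfl⟩⟩

/-- The relative Delaunay–Čech complex, `t ↦ j₁(Del(X₁)) ∪ ND_t`. -/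
def relDelCech (X₁ X₂ : Set (EuclideanSpace ℝ (Fin d))) (s ε : ℝ) :
    FilteredComplex (liftedPair X₁ X₂ s) where
  toFun t :=
    open Classical in
    (delaunayComplex X₁).map (j₁ X₁ X₂ s) ⊔ dowkerNerve (liftedDissim X₁ X₂ s ε) t
  monotone' _ _ hab := sup_le_sup_left ((dowkerNerve (liftedDissim X₁ X₂ s ε)).monotone hab) _

end Voronoi

/-! ### Simplicial homology of filtered simplicial complexes -/

/-- The simplicial set of ordered simplices of a simplicial complex: its `n`-simplices are the
tuples `(v₀, …, vₙ)` of vertices, repetitions allowed, such that `{v₀, …, vₙ}` is a simplex. Its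
chain complex is the ordered chain complex of the simplicial complex. -/
def toSSet {V : Type} (K : PreAbstractSimplicialComplex V) : SSet.{0} where
  obj n := {f : Fin (n.unop.len + 1) → V // open Classical in Finset.univ.image f ∈ K}
  map {m n} θ := TypeCat.ofHom fun f => ⟨fun i => f.1 (θ.unop.toOrderHom i), by
    classical
    refine (K.isRelLowerSet_faces f.2).2 ?_ (Finset.univ_nonempty.image _)
    intro v hv
    obtain ⟨i, -, rfl⟩ := Finset.mem_image.1 hv
    exact Finset.mem_image_of_mem _ (Finset.mem_univ _)⟩

/-- The simplicial set of ordered simplices, as a functor in the simplicial complex (for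
inclusions of simplicial complexes on a fixed vertex set). -/
def toSSetFunctor (V : Type) : PreAbstractSimplicialComplex V ⥤ SSet.{0} where
  obj K := toSSet K
  map {K L} i := { app := fun _ => TypeCat.ofHom fun f => ⟨f.1, leOfHom i f.2⟩ }

universe u

/-- The `n`-th reduced homology of simplicial sets with coefficients in `k`: the kernel of the map
induced in homology by the map to the point. -/
def reducedHomologyFunctor (k : Type u) [Field k] (n : ℕ) : SSet.{0} ⥤ ModuleCat.{u} k where
  obj K := kernel
    (SSet.homologyMap (SSet.stdSimplex.isTerminalObj₀.from K) (ModuleCat.of k k) n)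
  map {K L} f := kernel.map _ _ (SSet.homologyMap f (ModuleCat.of k k) n) (𝟙 _) (by
    rw [← SSet.homologyMap_comp, Category.comp_id]
    congr 1)
  map_id K := by
    rw [← cancel_mono (kernel.ι _)]
    simp
  map_comp f g := by
    rw [← cancel_mono (kernel.ι _)]
    simp [SSet.homologyMap_comp]

/-- The persistence module `t ↦ Hₙ(K t; k)` of a filtered simplicial complex. -/
def persistentHomology (k : Type u) [Field k] {V : Type} (K : FilteredComplex V) (n : ℕ) :
    Set.Ioi (0 : ℝ) ⥤ ModuleCat.{u} k :=
  K.monotone.functor ⋙ toSSetFunctor V ⋙ SSet.homologyFunctor (ModuleCat.of k k) n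

/-- The persistence module `t ↦ H̃ₙ(K t; k)` of a filtered simplicial complex. -/
def persistentReducedHomology (k : Type u) [Field k] {V : Type} (K : FilteredComplex V) (n : ℕ) :
    Set.Ioi (0 : ℝ) ⥤ ModuleCat.{u} k :=
  K.monotone.functor ⋙ toSSetFunctor V ⋙ reducedHomologyFunctor k n

/-! ### Relative singular homology of thickenings -/

/-- Relative singular homology `Hₙ(X, A; k)`: the homology of the quotient of the singular chain
complex of `X` by the image of that of `A`. -/
def relativeSingularHomology (k : Type u) [Field k] (n : ℕ) : TopPair.{0} ⥤ ModuleCat.{u} k :=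
  MorphismProperty.Arrow.forget _ _ _ ⋙
    ((AlgebraicTopology.singularChainComplexFunctor (ModuleCat.{u} k)).obj
      (ModuleCat.of k k)).mapArrow ⋙
    coker _ ⋙ HomologicalComplex.homologyFunctor (ModuleCat.{u} k) _ n

/-- The pair `(B, A)` of subspaces `A ⊆ B` of a topological space. -/
def pairOfSubset {E : Type} [TopologicalSpace E] {A B : Set E} (h : A ⊆ B) : TopPair.{0} :=
  TopPair.of (A := TopCat.of A) (X := TopCat.of B)
    (TopCat.ofHom ⟨Set.inclusion h, continuous_inclusion h⟩)
    (Topology.IsEmbedding.inclusion h)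

/-- The filtered pair `t ↦ (Xᵗ, Aᵗ)` of open Euclidean thickenings, for `A ⊆ X ⊆ ℝᵈ`. -/
def thickeningPair {d : ℕ} {A X : Set (EuclideanSpace ℝ (Fin d))} (h : A ⊆ X) :
    Set.Ioi (0 : ℝ) ⥤ TopPair.{0} where
  obj t := pairOfSubset (Metric.thickening_subset_of_subset (t : ℝ) h)
  map {a b} i := TopPair.ofHom
    (TopCat.ofHom ⟨Set.inclusion (Metric.thickening_mono (leOfHom i) X), continuous_inclusion _⟩)
    (TopCat.ofHom ⟨Set.inclusion (Metric.thickening_mono (leOfHom i) A), continuous_inclusion _⟩)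
    rfl

/-- The persistence module `t ↦ Hₙ(Xᵗ, Aᵗ; k)`. -/
def thickeningRelativeHomology (k : Type u) [Field k] {d : ℕ}
    {A X : Set (EuclideanSpace ℝ (Fin d))} (h : A ⊆ X) (n : ℕ) :
    Set.Ioi (0 : ℝ) ⥤ ModuleCat.{u} k :=
  thickeningPair h ⋙ relativeSingularHomology k n

end RelDelCech

end

/-! Over each $z\in Z$ put the cell $U_z=B(\mathrm{pr}(z),t)\times\mathrm{Vor}(Z,z)^\varepsilon$ in
$\mathbb{R}^d\times\mathbb{R}^{d+1}$ (`cellRel`). It is open and convex. Admissibility says that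
thickening the Voronoi cells creates no new simplices, so $ND_t$ is the nerve of these cells
(`dowkerNerve_liftedDissim`), and its part over $j_1(X_1)$ is the nerve of the cells coming from
$X_1$ (`cellRel₁`).

Three facts carry the proof. (1) Excision: $\mathrm{Vor}(Z,(x,s))$ projects into
$\mathrm{Vor}(X_1,x)$, because the lifted points of $X_1$ have equal height. Hence
$j_1(\mathrm{Del}(X_1))\cap ND_t$ is exactly the $X_1$-part of $ND_t$, and
$H(K_t,\mathrm{Del}(X_1))\cong H(ND_t,ND_t|_{X_1})$. (2) A nerve theorem for pairs
(`relH_iso_nerve`): the latter is the homology of the pair of unions of cells. (3) Projection to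
$\mathbb{R}^d$ maps these unions onto $(X_1\cup X_2)^t$ and $X_1^t$ with star-shaped fibres
(`hIso_fst`). The centre over $p$ is $(p,0)$ for the whole union and $(p,t^2/4s)$ for the
$X_1$-part, since at that height every point of $X_1$ within $t$ of $p$ beats all points of
$X_2\times\{-s\}$.

Finally $\mathrm{Del}(X_1)$ is the nerve of a convex open cover of $\mathbb{R}^d$, so it is acyclic
if $X_1\neq\emptyset$, and relative homology becomes reduced homology (`isIso_reduced_toRelH`). If
$X_1=\emptyset$ it has no simplices and relative homology is absolute.

The nerve theorem avoids partitions of unity. Dowker duality replaces the nerve on the cells by the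
complex of finite point sets contained in one cell; by convexity this is equivalent to the singular
simplices contained in one cell; barycentric subdivision passes from these to all singular simplices
of the union. All comparison maps are natural in $t$, and being a homology isomorphism is checked
for each $t$ separately (`relH_iso`). -/

noncomputable section

namespace RelDelCech

open scoped Simplicial

universe u

/-! ### Chain complexes of simplicial sets as finitely supported functions. -/

section Chains

variable (k : Type u) [Field k] (S : SSet.{0})

/-- The comparison of finitely supported functions on `n`-simplices with Mathlib's `n`-chains. -/
def toCh (n : ℕ) : (S _⦋n⦌ →₀ k) →ₗ[k] (S.chainComplex (ModuleCat.of k k)).X n :=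
  Finsupp.lsum k fun x => (S.ιChainComplex (R := ModuleCat.of k k) x).hom

/-- The inverse of `toCh`. -/
def ofCh (n : ℕ) : (S.chainComplex (ModuleCat.of k k)).X n ⟶ ModuleCat.of k (S _⦋n⦌ →₀ k) :=
  Sigma.desc fun x => ModuleCat.ofHom (Finsupp.lsingle x)

variable {S} in
lemma ι_ofCh {n : ℕ} (x : S _⦋n⦌) :
    S.ιChainComplex (R := ModuleCat.of k k) x ≫ ofCh k S n = ModuleCat.ofHom (Finsupp.lsingle x) :=
  Sigma.ι_desc _ _

variable {S} in
@[simp]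
lemma toCh_single {n : ℕ} (x : S _⦋n⦌) (a : k) :
    toCh k S n (Finsupp.single x a) = (S.ιChainComplex (R := ModuleCat.of k k) x).hom a := by
  simp [toCh]

lemma toCh_ofCh (n : ℕ) : ofCh k S n ≫ ModuleCat.ofHom (toCh k S n) = 𝟙 _ := by
  apply SSet.chainComplex_hom_ext
  intro x
  rw [← Category.assoc, ι_ofCh]
  ext
  simp

lemma ofCh_toCh (n : ℕ) : ModuleCat.ofHom (toCh k S n) ≫ ofCh k S n = 𝟙 _ := by
  ext x : 2
  ext
  have := ConcreteCategory.congr_hom (ι_ofCh k x) (1 : k)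
  simp at this ⊢
  simp [this]

lemma toCh_bijective (n : ℕ) : Function.Bijective (toCh k S n) := by
  refine Function.bijective_iff_has_inverse.2 ⟨(ofCh k S n).hom, fun x => ?_, fun x => ?_⟩
  · exact ConcreteCategory.congr_hom (ofCh_toCh k S n) x
  · exact ConcreteCategory.congr_hom (toCh_ofCh k S n) x

/-- The boundary operator on finitely supported functions on simplices. -/
def bd (n : ℕ) : (S _⦋n + 1⦌ →₀ k) →ₗ[k] (S _⦋n⦌ →₀ k) :=
  ∑ i : Fin (n + 2), (-1 : k) ^ (i : ℕ) • Finsupp.lmapDomain k k (S.δ i)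

lemma bd_single (n : ℕ) (x : S _⦋n + 1⦌) (a : k) :
    bd k S n (Finsupp.single x a) =
      ∑ i : Fin (n + 2), (-1 : k) ^ (i : ℕ) • Finsupp.single (S.δ i x) a := by
  simp [bd, Finsupp.mapDomain_single]

lemma d_toCh (n : ℕ) (c : S _⦋n + 1⦌ →₀ k) :
    ((S.chainComplex (ModuleCat.of k k)).d (n + 1) n).hom (toCh k S (n + 1) c) =
      toCh k S n (bd k S n c) := by
  induction c using Finsupp.induction_linear with
  | zero => simp
  | add f g hf hg => simp only [map_add, hf, hg]
  | single x a =>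
    have := ConcreteCategory.congr_hom (S.ιChainComplex_d (ModuleCat.of k k) x) a
    simp only [ModuleCat.hom_comp, LinearMap.comp_apply] at this
    rw [toCh_single, bd_single]
    refine this.trans ?_
    simp only [ModuleCat.hom_sum, map_sum, LinearMap.sum_apply]
    refine Finset.sum_congr rfl fun i _ => ?_
    rw [map_smul, toCh_single]
    rcases Nat.even_or_odd (i : ℕ) with hi | hi <;> simp [hi.neg_one_pow]

variable {S} {S' : SSet.{0}} (f : S ⟶ S')

lemma map_toCh (n : ℕ) (c : S _⦋n⦌ →₀ k) :
    ((SSet.chainComplexMap f (ModuleCat.of k k)).f n).hom (toCh k S n c) =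
      toCh k S' n (Finsupp.mapDomain (f.app _) c) := by
  induction c using Finsupp.induction_linear with
  | zero => simp
  | add f g hf hg => simp only [map_add, Finsupp.mapDomain_add, hf, hg]
  | single x a =>
    have := ConcreteCategory.congr_hom (SSet.ι_chainComplexMap_f S S' f (ModuleCat.of k k) x) a
    rw [toCh_single, Finsupp.mapDomain_single, toCh_single]
    exact this

/-- The chains supported on the image of a map of simplicial sets. -/
abbrev imChains (n : ℕ) : Submodule k (S' _⦋n⦌ →₀ k) :=
  Finsupp.supported k k (Set.range (f.app (Opposite.op ⦋n⦌)))

variable {f} in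
lemma mem_imChains_iff {n : ℕ} {c : S' _⦋n⦌ →₀ k} :
    c ∈ imChains k f n ↔ ∃ a, Finsupp.mapDomain (f.app _) a = c := by
  have := LinearMap.range_eq_map (Finsupp.lmapDomain k k (f.app (Opposite.op ⦋n⦌)))
  rw [← Finsupp.supported_univ, Finsupp.lmapDomain_supported, Set.image_univ] at this
  rw [imChains, ← this]
  rfl

lemma mono_chainComplexMap [Mono f] : Mono (SSet.chainComplexMap f (ModuleCat.of k k)) := by
  have (n : ℕ) : Mono ((SSet.chainComplexMap f (ModuleCat.of k k)).f n) := by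
    rw [ModuleCat.mono_iff_injective]
    intro a b hab
    obtain ⟨a, rfl⟩ := (toCh_bijective k S n).2 a
    obtain ⟨b, rfl⟩ := (toCh_bijective k S n).2 b
    have h := (map_toCh k f n a).symm.trans (hab.trans (map_toCh k f n b))
    have hf : Function.Injective (f.app (Opposite.op ⦋n⦌)) := by
      rw [← mono_iff_injective]; infer_instance
    rw [Finsupp.mapDomain_injective hf ((toCh_bijective k S' n).1 h)]
  exact HomologicalComplex.mono_of_mono_f _ this

/-- The short complex of chain complexes `C(S) → C(S') → C(S') / C(S)`. -/
abbrev relSC : ShortComplex (ChainComplex (ModuleCat.{u} k) ℕ) :=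
  ShortComplex.mk (SSet.chainComplexMap f (ModuleCat.of k k))
    (cokernel.π (SSet.chainComplexMap f (ModuleCat.of k k))) (cokernel.condition _)

lemma relSC_shortExact [Mono f] : (relSC k f).ShortExact := by
  have := mono_chainComplexMap k (f := f)
  exact { exact := ShortComplex.exact_cokernel _ }

variable {f} in
lemma quasiIso_of_acyclic [Mono f] (h : (relSC k f).X₃.Acyclic) :
    QuasiIso (SSet.chainComplexMap f (ModuleCat.of k k)) := by
  have hS := relSC_shortExact k f
  rw [quasiIso_iff]
  intro i
  rw [quasiIsoAt_iff_isIso_homologyMap]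
  have h0 (j : ℕ) : IsZero ((relSC k f).X₃.homology j) := (h j).isZero_homology
  have : Epi (HomologicalComplex.homologyMap (relSC k f).f i) :=
    (hS.homology_exact₂ i).epi_f ((h0 i).eq_of_tgt _ _)
  have : Mono (HomologicalComplex.homologyMap (relSC k f).f i) :=
    (hS.homology_exact₁ (i + 1) i rfl).mono_g ((h0 (i + 1)).eq_of_src _ _)
  exact isIso_of_mono_of_epi _

variable {f} in
lemma relSC_g_surjective (n : ℕ) : Function.Surjective ((relSC k f).g.f n) := by
  rw [← ModuleCat.epi_iff_surjective]
  infer_instance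

variable {f} in
lemma relSC_g_toCh_eq_zero_iff [Mono f] (n : ℕ) (c : S' _⦋n⦌ →₀ k) :
    (relSC k f).g.f n (toCh k S' n c) = 0 ↔ c ∈ imChains k f n := by
  have h := ((relSC_shortExact k f).exact.map (HomologicalComplex.eval _ _ n))
  rw [ShortComplex.moduleCat_exact_iff_range_eq_ker] at h
  rw [mem_imChains_iff]
  change toCh k S' n c ∈ LinearMap.ker _ ↔ _
  refine (iff_of_eq (congrArg (toCh k S' n c ∈ ·) h.symm)).trans ?_
  constructor
  · rintro ⟨a, ha⟩
    obtain ⟨a, rfl⟩ := (toCh_bijective k S n).2 a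
    exact ⟨a, (toCh_bijective k S' n).1 ((map_toCh k f n a).symm.trans ha)⟩
  · rintro ⟨a, rfl⟩
    exact ⟨toCh k S n a, map_toCh k f n a⟩

-- The hypotheses say that every relative cycle is a relative boundary modulo chains in the image,
-- so the quotient complex is acyclic and the long exact sequence applies. This turns homology
-- isomorphisms into questions about explicit operators on formal sums.
variable {f} in
theorem quasiIso_of_chains [Mono f]
    (h₀ : ∀ c : S' _⦋0⦌ →₀ k, ∃ b, c - bd k S' 0 b ∈ imChains k f 0)
    (h : ∀ (n : ℕ) (c : S' _⦋n + 1⦌ →₀ k), bd k S' n c ∈ imChains k f n →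
      ∃ b, c - bd k S' (n + 1) b ∈ imChains k f (n + 1)) :
    QuasiIso (SSet.chainComplexMap f (ModuleCat.of k k)) := by
  apply quasiIso_of_acyclic
  have key (n : ℕ) (c : S' _⦋n⦌ →₀ k) (b) (hb : c - bd k S' n b ∈ imChains k f n) :
      ((relSC k f).X₃.d (n + 1) n) ((relSC k f).g.f (n + 1) (toCh k S' (n + 1) b)) =
      (relSC k f).g.f n (toCh k S' n c) := by
    have h1 := ConcreteCategory.congr_hom ((relSC k f).g.comm (n + 1) n) (toCh k S' (n + 1) b)
    have h2 := (relSC_g_toCh_eq_zero_iff k n _).2 hb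
    simp only [map_sub, sub_eq_zero] at h2
    rw [h2]
    exact h1.trans (congrArg ((relSC k f).g.f n) (d_toCh k S' n b))
  rintro (_ | n)
  · rw [HomologicalComplex.exactAt_iff' _ 1 0 0 (by simp) (by simp),
      ShortComplex.moduleCat_exact_iff]
    intro x hx
    obtain ⟨x, rfl⟩ := relSC_g_surjective k 0 x
    obtain ⟨c, rfl⟩ := (toCh_bijective k S' 0).2 x
    obtain ⟨b, hb⟩ := h₀ c
    exact ⟨_, key 0 c b hb⟩
  · rw [HomologicalComplex.exactAt_iff' _ (n + 2) (n + 1) n (by simp) (by simp),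
      ShortComplex.moduleCat_exact_iff]
    intro x hx
    obtain ⟨x, rfl⟩ := relSC_g_surjective k (n + 1) x
    obtain ⟨c, rfl⟩ := (toCh_bijective k S' (n + 1)).2 x
    have h1 := ConcreteCategory.congr_hom ((relSC k f).g.comm (n + 1) n) (toCh k S' (n + 1) c)
    have h2 : (relSC k f).g.f n (toCh k S' n (bd k S' n c)) = 0 :=
      (congrArg ((relSC k f).g.f n) (d_toCh k S' n c)).symm.trans (h1.symm.trans hx)
    obtain ⟨b, hb⟩ := h n c ((relSC_g_toCh_eq_zero_iff k n _).1 h2)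
    exact ⟨_, key (n + 1) c b hb⟩

end Chains

/-! ### Relative homology of maps of simplicial sets: invariance, excision, comparison with reduced
homology. -/

section Relative

variable (k : Type u) [Field k]

/-- A map of simplicial sets is a homology isomorphism if it is a quasi-isomorphism on chains. -/
abbrev HIso {S T : SSet.{0}} (f : S ⟶ T) : Prop :=
  QuasiIso (SSet.chainComplexMap f (ModuleCat.of k k))

variable {k} in
lemma HIso.isIso {S T : SSet.{0}} {f : S ⟶ T} (h : HIso k f) (n : ℕ) :
    IsIso (SSet.homologyMap f (ModuleCat.of k k) n) := by
  rw [SSet.homologyMap]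
  infer_instance

lemma hIso_comp {S T U : SSet.{0}} {f : S ⟶ T} {g : T ⟶ U} (hf : HIso k f) (hg : HIso k g) :
    HIso k (f ≫ g) := by
  rw [HIso, SSet.chainComplexMap, Functor.map_comp]
  exact quasiIso_comp _ _

lemma hIso_of_comp_left {S T U : SSet.{0}} {f : S ⟶ T} {g : T ⟶ U} (hf : HIso k f)
    (hfg : HIso k (f ≫ g)) : HIso k g := by
  rw [HIso, SSet.chainComplexMap, Functor.map_comp] at hfg
  exact quasiIso_of_comp_left (SSet.chainComplexMap f (ModuleCat.of k k)) _

lemma hIso_of_isIso {S T : SSet.{0}} (f : S ⟶ T) [IsIso f] : HIso k f := by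
  rw [HIso, SSet.chainComplexMap]
  infer_instance

lemma hIso_of_homotopy {S T : SSet.{0}} {f : S ⟶ T} {g : T ⟶ S}
    (h₁ : SSet.Homotopy (f ≫ g) (𝟙 S)) (h₂ : g ≫ f = 𝟙 T) : HIso k f := by
  rw [HIso, quasiIso_iff]
  intro n
  rw [quasiIsoAt_iff_isIso_homologyMap]
  refine ⟨SSet.homologyMap g (ModuleCat.of k k) n, ?_, ?_⟩
  · exact (SSet.homologyMap_comp _ _ _ f g _ n).symm.trans
      ((h₁.congr_homologyMap _ n).trans (SSet.homologyMap_id _ _ n))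
  · exact (SSet.homologyMap_comp _ _ _ g f _ n).symm.trans
      ((congrArg (SSet.homologyMap · _ n) h₂).trans (SSet.homologyMap_id _ _ n))

/-- The relative homology of a map of simplicial sets. -/
def relH (n : ℕ) : Arrow SSet.{0} ⥤ ModuleCat.{u} k :=
  ((SSet.chainComplexFunctor (ModuleCat.{u} k)).obj (ModuleCat.of k k)).mapArrow ⋙
    coker _ ⋙ HomologicalComplex.homologyFunctor (ModuleCat.{u} k) _ n

variable {k}

/-- The map of relative chain complexes induced by a map of arrows. -/
abbrev relMap {f g : Arrow SSet.{0}} (φ : f ⟶ g) : (relSC k f.hom).X₃ ⟶ (relSC k g.hom).X₃ :=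
  (((SSet.chainComplexFunctor (ModuleCat.{u} k)).obj (ModuleCat.of k k)).mapArrow ⋙
    coker _).map φ

lemma g_relMap {f g : Arrow SSet.{0}} (φ : f ⟶ g) :
    (relSC k f.hom).g ≫ relMap φ = SSet.chainComplexMap φ.right _ ≫ (relSC k g.hom).g :=
  cokernel.π_desc _ _ _

/-- The map of short complexes induced by a map of arrows. -/
def relSCMap {f g : Arrow SSet.{0}} (φ : f ⟶ g) : relSC k f.hom ⟶ relSC k g.hom where
  τ₁ := SSet.chainComplexMap φ.left _
  τ₂ := SSet.chainComplexMap φ.right _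
  τ₃ := relMap φ
  comm₁₂ := by
    simp only [relSC, SSet.chainComplexMap, ← Functor.map_comp, Arrow.w φ]
  comm₂₃ := (g_relMap φ).symm

/-- The five lemma for the long exact sequences of the two pairs. -/
lemma isIso_relH_map {f g : Arrow SSet.{0}} (φ : f ⟶ g) [Mono f.hom] [Mono g.hom]
    (h₁ : HIso k φ.left) (h₂ : HIso k φ.right) (n : ℕ) : IsIso ((relH k n).map φ) := by
  have := HomologicalComplex.HomologySequence.quasiIso_τ₃ (relSCMap (k := k) φ)
    (relSC_shortExact k f.hom) (relSC_shortExact k g.hom) h₁ h₂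
  change IsIso (HomologicalComplex.homologyMap (relSCMap (k := k) φ).τ₃ n)
  infer_instance

lemma relMap_g_toCh {f g : Arrow SSet.{0}} (φ : f ⟶ g) (n : ℕ) (c : f.right _⦋n⦌ →₀ k) :
    (relMap φ).f n ((relSC k f.hom).g.f n (toCh k _ n c)) =
      (relSC k g.hom).g.f n (toCh k _ n (Finsupp.mapDomain (φ.right.app _) c)) := by
  have h := ConcreteCategory.congr_hom (HomologicalComplex.congr_hom (g_relMap (k := k) φ) n)
    (toCh k _ n c)
  exact h.trans (congrArg ((relSC k g.hom).g.f n) (map_toCh k φ.right n c))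

/-- Excision for simplicial sets. -/
lemma isIso_relH_map_of_excision {f g : Arrow SSet.{0}} (φ : f ⟶ g) [Mono f.hom] [Mono g.hom]
    (hφ : ∀ m, Function.Injective (φ.right.app m))
    (h₁ : ∀ m (x : g.right.obj m), x ∈ Set.range (g.hom.app m) ∨ x ∈ Set.range (φ.right.app m))
    (h₂ : ∀ m (x : f.right.obj m), φ.right.app m x ∈ Set.range (g.hom.app m) →
      x ∈ Set.range (f.hom.app m))
    (n : ℕ) : IsIso ((relH k n).map φ) := by
  classical
  have (n : ℕ) : IsIso ((relMap (k := k) φ).f n) := by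
    rw [ConcreteCategory.isIso_iff_bijective]
    constructor
    · rw [injective_iff_map_eq_zero]
      intro x hx
      obtain ⟨x, rfl⟩ := relSC_g_surjective k n x
      obtain ⟨c, rfl⟩ := (toCh_bijective k _ n).2 x
      rw [relMap_g_toCh, relSC_g_toCh_eq_zero_iff] at hx
      rw [relSC_g_toCh_eq_zero_iff]
      intro x hx'
      refine h₂ _ x (hx ?_)
      rw [Finsupp.mapDomain_support_of_injective (hφ _)]
      exact Finset.mem_coe.2 (Finset.mem_image_of_mem _ hx')
    · intro y
      obtain ⟨y, rfl⟩ := relSC_g_surjective k n y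
      obtain ⟨c, rfl⟩ := (toCh_bijective k _ n).2 y
      -- Modulo chains of the subobject only the simplices outside it matter, and those lift along
      -- `φ.right`.
      have h3 : c.filter (· ∉ Set.range (g.hom.app _)) ∈ imChains k φ.right n := by
        intro x hx
        simp only [Finset.mem_coe, Finsupp.support_filter, Finset.mem_filter] at hx
        exact (h₁ _ x).resolve_left hx.2
      obtain ⟨a, ha⟩ := (mem_imChains_iff k).1 h3
      refine ⟨(relSC k f.hom).g.f n (toCh k _ n a), ?_⟩
      rw [relMap_g_toCh, ← sub_eq_zero, ← map_sub, ← map_sub, relSC_g_toCh_eq_zero_iff, ha]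
      intro x hx
      by_contra hx'
      exact Finsupp.mem_support_iff.1 hx
        (by rw [Finsupp.sub_apply, Finsupp.filter_apply_pos (· ∉ _) c hx', sub_self])
  have : IsIso (relMap (k := k) φ) := HomologicalComplex.Hom.isIso_of_components _
  change IsIso (HomologicalComplex.homologyMap (relMap (k := k) φ) n)
  infer_instance

/-- The functor to arrows given by a natural transformation. -/
def arrowFunctor {T : Type} [SmallCategory T] {C : Type*} [Category* C] {F G : T ⥤ C} (α : F ⟶ G) :
    T ⥤ Arrow C where
  obj t := Arrow.mk (α.app t)
  map {s t} i := Arrow.homMk (F.map i) (G.map i) (by simp)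

/-- The natural transformation of arrow functors given by a commutative square. -/
def arrowFunctorMap {T : Type} [SmallCategory T] {C : Type*} [Category* C] {F G F' G' : T ⥤ C}
    {α : F ⟶ G} {α' : F' ⟶ G'} (β : F ⟶ F') (γ : G ⟶ G') (h : β ≫ α' = α ≫ γ) :
    arrowFunctor α ⟶ arrowFunctor α' where
  app t := Arrow.homMk (β.app t) (γ.app t) (congrArg (fun η => η.app t) h)
  naturality _ _ i := Arrow.hom_ext _ _ (β.naturality i) (γ.naturality i)

/-- Only the comparison maps must be natural in the parameter. Homotopy inverses may be chosen at
each `t` without any compatibility. -/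
lemma relH_iso {T : Type} [SmallCategory T] {F G F' G' : T ⥤ SSet.{0}}
    {α : F ⟶ G} {α' : F' ⟶ G'} (β : F ⟶ F') (γ : G ⟶ G') (h : β ≫ α' = α ≫ γ)
    (hα : ∀ t, Mono (α.app t)) (hα' : ∀ t, Mono (α'.app t))
    (hβ : ∀ t, HIso k (β.app t)) (hγ : ∀ t, HIso k (γ.app t)) (n : ℕ) :
    Nonempty (arrowFunctor α ⋙ relH k n ≅ arrowFunctor α' ⋙ relH k n) := by
  have (t : T) : IsIso ((relH k n).map ((arrowFunctorMap β γ h).app t)) :=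
    have : Mono ((arrowFunctor α).obj t).hom := hα t
    have : Mono ((arrowFunctor α').obj t).hom := hα' t
    isIso_relH_map ((arrowFunctorMap β γ h).app t) (hβ t) (hγ t) n
  exact ⟨NatIso.ofComponents (fun t => @asIso _ _ _ _ _ (this t)) fun i => by
    simp only [Functor.comp_map, asIso_hom, ← Functor.map_comp, NatTrans.naturality]⟩

/-- The quotient map from absolute to relative homology. -/
def toRelH (n : ℕ) : Arrow.rightFunc ⋙ SSet.homologyFunctor (ModuleCat.of k k) n ⟶ relH k n :=
  Functor.whiskerRight (Functor.whiskerLeft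
    ((SSet.chainComplexFunctor (ModuleCat.{u} k)).obj (ModuleCat.of k k)).mapArrow
    (coker.π (ChainComplex (ModuleCat.{u} k) ℕ)))
    (HomologicalComplex.homologyFunctor (ModuleCat.{u} k) _ n)

lemma toRelH_app (n : ℕ) (f : Arrow SSet.{0}) :
    (toRelH n).app f = HomologicalComplex.homologyMap (relSC k f.hom).g n := rfl

/-- Since `S.f ≫ p` is invertible, `S.X₂` is the direct sum of the image of `S.f` and the kernel of
`p`, so the kernel maps isomorphically to the quotient. -/
lemma isIso_kernel_ι_comp {C : Type*} [Category* C] [Abelian C] {S : ShortComplex C}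
    (hS : S.Exact) (hg : Epi S.g) {P : C} (p : S.X₂ ⟶ P) (h : IsIso (S.f ≫ p)) :
    IsIso (kernel.ι p ≫ S.g) := by
  have : Mono S.f := mono_of_mono S.f p
  have h1 : Mono (kernel.ι p ≫ S.g) := by
    refine Preadditive.mono_of_cancel_zero _ fun {G} x hx => ?_
    have hy := hS.lift_f (x ≫ kernel.ι p) (by simpa using hx)
    rw [← cancel_mono (kernel.ι p), zero_comp, ← hy]
    have : hS.lift (x ≫ kernel.ι p) (by simpa using hx) = 0 := by
      rw [← cancel_mono (S.f ≫ p), ← Category.assoc, hy]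
      simp
    rw [this, zero_comp]
  have h2 : Epi (kernel.ι p ≫ S.g) := by
    refine Preadditive.epi_of_cancel_zero _ fun {G} x hx => ?_
    -- This is the projector onto the kernel of `p`; its correction term is killed by `S.g`.
    have h3 : (𝟙 _ - p ≫ inv (S.f ≫ p) ≫ S.f) ≫ p = 0 := by simp
    rw [← cancel_epi S.g, comp_zero]
    have h4 := kernel.lift_ι p _ h3
    have h5 : (𝟙 _ - p ≫ inv (S.f ≫ p) ≫ S.f) ≫ S.g ≫ x = 0 := by
      rw [← h4, Category.assoc]
      simp only [Category.assoc] at hx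
      rw [hx, comp_zero]
    simpa [Preadditive.sub_comp] using h5
  exact isIso_of_mono_of_epi _

/-- The isomorphism from the homology of `f.left` to that of the point factors through `f.right`.
Hence `f.hom` is injective on homology, the connecting maps vanish, and the relative homology is a
complement of the homology of the point. -/
lemma isIso_reduced_toRelH (f : Arrow SSet.{0}) [Mono f.hom]
    (h : HIso k (SSet.stdSimplex.isTerminalObj₀.from f.left)) (n : ℕ) :
    IsIso (kernel.ι (SSet.homologyMap (SSet.stdSimplex.isTerminalObj₀.from f.right)
      (ModuleCat.of k k) n) ≫ (toRelH n).app f) := by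
  set R := ModuleCat.of k k
  have hS := relSC_shortExact k f.hom
  have hi (m : ℕ) : SSet.homologyMap f.hom R m ≫
      SSet.homologyMap (SSet.stdSimplex.isTerminalObj₀.from f.right) R m =
      SSet.homologyMap (SSet.stdSimplex.isTerminalObj₀.from f.left) R m := by
    rw [← SSet.homologyMap_comp]
    congr 1
  have hiso (m : ℕ) : IsIso (SSet.homologyMap f.hom R m ≫
      SSet.homologyMap (SSet.stdSimplex.isTerminalObj₀.from f.right) R m) := by
    rw [hi]
    exact h.isIso m
  have hmono (m : ℕ) : Mono (SSet.homologyMap f.hom R m) := mono_of_mono _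
    (SSet.homologyMap (SSet.stdSimplex.isTerminalObj₀.from f.right) R m)
  have hepi : Epi (HomologicalComplex.homologyMap (relSC k f.hom).g n) := by
    have := hS.epi_g
    rcases n with _ | n
    · exact HomologicalComplex.epi_homologyMap_of_epi_of_not_rel _ _ (by simp)
    · refine (hS.homology_exact₃ (n + 1) n rfl).epi_f ?_
      have := hmono n
      rw [← cancel_mono (SSet.homologyMap f.hom R n)]
      exact (hS.δ_comp (n + 1) n rfl).trans zero_comp.symm
  rw [toRelH_app]
  have := hiso n
  exact isIso_kernel_ι_comp (hS.homology_exact₂ n) hepi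
    (SSet.homologyMap (SSet.stdSimplex.isTerminalObj₀.from f.right) R n) this

lemma isIso_toRelH_of_isEmpty (f : Arrow SSet.{0}) (h : ∀ m, IsEmpty (f.left.obj m)) (n : ℕ) :
    IsIso ((toRelH (k := k) n).app f) := by
  have hz : SSet.chainComplexMap f.hom (ModuleCat.of k k) = 0 := by
    ext m : 1
    exact SSet.chainComplex_hom_ext fun x => ((h _).false x).elim
  have key {X Y : ChainComplex (ModuleCat.{u} k) ℕ} (g : X ⟶ Y) (hg : g = 0) :
      IsIso (cokernel.π g) := by
    subst hg
    infer_instance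
  have : IsIso (relSC k f.hom).g := key _ hz
  change IsIso ((HomologicalComplex.homologyFunctor (ModuleCat.{u} k) _ n).map (relSC k f.hom).g)
  infer_instance

end Relative

/-! ### The augmented complex of ordered tuples and its cone operator. -/

section Tuples

variable (k : Type u) [Field k] {V : Type}

/-- The boundary operator of the augmented complex of ordered tuples in `V`. -/
def tbd (n : ℕ) : ((Fin (n + 1) → V) →₀ k) →ₗ[k] ((Fin n → V) →₀ k) :=
  ∑ i : Fin (n + 1), (-1 : k) ^ (i : ℕ) • Finsupp.lmapDomain k k (fun p => p ∘ i.succAbove)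

lemma tbd_single (n : ℕ) (p : Fin (n + 1) → V) (a : k) :
    tbd k n (Finsupp.single p a) =
      ∑ i : Fin (n + 1), (-1 : k) ^ (i : ℕ) • Finsupp.single (p ∘ i.succAbove) a := by
  simp [tbd, Finsupp.mapDomain_single]

/-- The cone operator on ordered tuples. -/
def tcone (v : V) (n : ℕ) : ((Fin n → V) →₀ k) →ₗ[k] ((Fin (n + 1) → V) →₀ k) :=
  Finsupp.lmapDomain k k (fun p => (Fin.cons v p : Fin (n + 1) → V))

@[simp]
lemma tcone_single (v : V) (n : ℕ) (p : Fin n → V) (a : k) :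
    tcone k v n (Finsupp.single p a) = Finsupp.single (Fin.cons v p : Fin (n + 1) → V) a := by
  simp [tcone, Finsupp.mapDomain_single]

lemma cons_comp_succAbove_zero (v : V) {n : ℕ} (p : Fin n → V) :
    (Fin.cons v p : Fin (n + 1) → V) ∘ (0 : Fin (n + 1)).succAbove = p := by
  ext i; simp

lemma cons_comp_succAbove_succ (v : V) {n : ℕ} (p : Fin (n + 1) → V) (i : Fin (n + 1)) :
    (Fin.cons v p : Fin (n + 2) → V) ∘ i.succ.succAbove =
      (Fin.cons v (p ∘ i.succAbove) : Fin (n + 1) → V) := by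
  ext j
  refine Fin.cases ?_ (fun j => ?_) j <;> simp

lemma tbd_zero_tcone (v : V) (c : (Fin 0 → V) →₀ k) : tbd k 0 (tcone k v 0 c) = c := by
  induction c using Finsupp.induction_linear with
  | zero => simp
  | add f g hf hg => simp only [map_add, hf, hg]
  | single p a => simp [tbd_single, cons_comp_succAbove_zero, -Fin.succAbove_zero]

lemma tbd_tcone (v : V) (n : ℕ) (c : (Fin (n + 1) → V) →₀ k) :
    tbd k (n + 1) (tcone k v (n + 1) c) = c - tcone k v n (tbd k n c) := by
  induction c using Finsupp.induction_linear with
  | zero => simp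
  | add f g hf hg => simp only [map_add, hf, hg]; abel
  | single p a =>
    rw [tcone_single, tbd_single, Fin.sum_univ_succ, tbd_single, map_sum,
      cons_comp_succAbove_zero, sub_eq_add_neg, ← Finset.sum_neg_distrib]
    simp only [cons_comp_succAbove_succ, map_smul, tcone_single, Fin.val_zero, pow_zero, one_smul,
      Fin.val_succ, pow_succ, mul_neg, mul_one, neg_smul]

/-- Every nonempty tuple is a cone over its tail, so the cone identity $\partial(v*c)=c-v*\partial
c$ reduces the claim to one degree lower, with no double sum over faces. -/
lemma tbd_tbd (n : ℕ) (c : (Fin (n + 2) → V) →₀ k) : tbd k n (tbd k (n + 1) c) = 0 := by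
  induction c using Finsupp.induction_linear with
  | zero => simp
  | add f g hf hg => simp only [map_add, hf, hg, add_zero]
  | single p a =>
    obtain ⟨v, p, rfl⟩ : ∃ v q, p = Fin.cons v q := ⟨p 0, Fin.tail p, by simp⟩
    rw [← tcone_single, tbd_tcone, map_sub]
    induction n generalizing v with
    | zero => rw [tbd_zero_tcone, sub_self]
    | succ n ih =>
      rw [tbd_tcone]
      obtain ⟨w, p, rfl⟩ : ∃ v q, p = Fin.cons v q := ⟨p 0, Fin.tail p, by simp⟩
      have := ih w p
      rw [← map_sub, ← tbd_tcone, tcone_single] at this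
      rw [this, map_zero]
      simp

lemma linearMap_mem_of_supported {α M : Type*} [AddCommGroup M] [Module k M]
    (f : (α →₀ k) →ₗ[k] M) {s : Set α} {N : Submodule k M}
    (h : ∀ x ∈ s, f (Finsupp.single x 1) ∈ N) {c : α →₀ k} (hc : c ∈ Finsupp.supported k k s) :
    f c ∈ N := by
  have : Finsupp.supported k k s ≤ N.comap f := by
    rw [Finsupp.supported_eq_span_single, Submodule.span_le]
    rintro _ ⟨x, hx, rfl⟩
    exact h x hx
  exact this hc

end Tuples

/-! ### Removing vertices from a simplicial complex by coning. -/

section Cone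

open Classical in
/-- The vertices of a tuple satisfying `P`. -/
def vertexPart {V : Type} (P : V → Prop) {n : ℕ} (w : Fin n → V) : Finset V :=
  (Finset.univ.image w).filter P

variable {V : Type} {P : V → Prop}

lemma mem_vertexPart {n : ℕ} {w : Fin n → V} {v : V} :
    v ∈ vertexPart P w ↔ (∃ i, w i = v) ∧ P v := by
  simp [vertexPart]

lemma vertexPart_comp_subset {n m : ℕ} (w : Fin n → V) (g : Fin m → Fin n) :
    vertexPart P (w ∘ g) ⊆ vertexPart P w := by
  intro v
  simp only [mem_vertexPart]
  rintro ⟨⟨i, rfl⟩, h⟩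
  exact ⟨⟨g i, rfl⟩, h⟩

lemma vertexPart_cons {n : ℕ} {w : Fin n → V} {z : V} (hz : ¬ P z) :
    vertexPart P (Fin.cons z w : Fin (n + 1) → V) = vertexPart P w := by
  ext v
  simp only [mem_vertexPart, Fin.exists_fin_succ, Fin.cons_zero, Fin.cons_succ]
  constructor
  · rintro ⟨rfl | h, h'⟩
    exacts [(hz h').elim, ⟨h, h'⟩]
  · exact fun h => ⟨Or.inr h.1, h.2⟩

variable (k : Type u) [Field k] (P) (c : Finset V → V)

open Classical in
/-- The operator prepending to a tuple the cone point attached to its vertices satisfying `P`. -/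
def coneOp (n : ℕ) : ((Fin n → V) →₀ k) →ₗ[k] ((Fin (n + 1) → V) →₀ k) :=
  Finsupp.linearCombination k fun w =>
    if (vertexPart P w).Nonempty then
      Finsupp.single (Fin.cons (c (vertexPart P w)) w : Fin (n + 1) → V) 1 else 0

variable {P}

lemma coneOp_single_of_nonempty {n : ℕ} {w : Fin n → V} (h : (vertexPart P w).Nonempty) :
    coneOp P k c n (Finsupp.single w 1) =
      Finsupp.single (Fin.cons (c (vertexPart P w)) w : Fin (n + 1) → V) 1 := by
  simp [coneOp, h]

lemma coneOp_single_of_not_nonempty {n : ℕ} {w : Fin n → V} (h : ¬ (vertexPart P w).Nonempty) :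
    coneOp P k c n (Finsupp.single w 1) = 0 := by
  simp [coneOp, h]

open Classical in
/-- The tuples spanning a simplex of `L`. -/
def tuplesOf (L : PreAbstractSimplicialComplex V) (n : ℕ) : Set (Fin n → V) :=
  {w | Finset.univ.image w ∈ L}

variable {L K : PreAbstractSimplicialComplex V}

lemma tuplesOf_comp {n m : ℕ} {w : Fin n → V} (hw : w ∈ tuplesOf L n)
    (g : Fin (m + 1) → Fin n) : w ∘ g ∈ tuplesOf L (m + 1) := by
  classical
  refine (L.isRelLowerSet_faces hw).2 ?_ (Finset.univ_nonempty.image _)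
  intro v hv
  simp only [Finset.mem_image, Finset.mem_univ, true_and] at hv ⊢
  obtain ⟨i, rfl⟩ := hv
  exact ⟨g i, rfl⟩

variable (P L) in
/-- Chains on tuples of `L` with at most `m` vertices satisfying `P`. -/
abbrev partFiltration (m n : ℕ) : Submodule k ((Fin n → V) →₀ k) :=
  Finsupp.supported k k {w | w ∈ tuplesOf L n ∧ (vertexPart P w).card ≤ m}

open Classical in
/-- `c` chooses for every nonempty set of vertices satisfying `P` a vertex coning off all simplices
of `L` with exactly these vertices satisfying `P`. -/
def IsConing (P : V → Prop) (L : PreAbstractSimplicialComplex V) (c : Finset V → V) : Prop :=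
  ∀ σ ∈ L, (σ.filter P).Nonempty → ¬ P (c (σ.filter P)) ∧ insert (c (σ.filter P)) σ ∈ L

variable {c}

lemma IsConing.cons_mem (hc : IsConing P L c) {n : ℕ} {w : Fin n → V} (hw : w ∈ tuplesOf L n)
    (h : (vertexPart P w).Nonempty) :
    (Fin.cons (c (vertexPart P w)) w : Fin (n + 1) → V) ∈ tuplesOf L (n + 1) := by
  classical
  have := (hc _ hw h).2
  rw [tuplesOf, Set.mem_ofPred_eq]
  convert this using 1
  ext v
  simp only [Finset.mem_image, Finset.mem_univ, true_and, Fin.exists_fin_succ, Fin.cons_zero,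
    Fin.cons_succ, Finset.mem_insert, eq_comm (a := v)]
  rfl

lemma IsConing.not_mem (hc : IsConing P L c) {n : ℕ} {w : Fin n → V} (hw : w ∈ tuplesOf L n)
    (h : (vertexPart P w).Nonempty) : ¬ P (c (vertexPart P w)) := by
  exact (hc _ hw h).1

lemma coneOp_mem (hc : IsConing P L c) {n m : ℕ} {w : (Fin n → V) →₀ k}
    (hw : w ∈ partFiltration P k L m n) : coneOp P k c n w ∈ partFiltration P k L m (n + 1) := by
  refine linearMap_mem_of_supported k _ (fun w hw => ?_) hw
  by_cases h : (vertexPart P w).Nonempty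
  · rw [coneOp_single_of_nonempty k c h]
    refine Finsupp.single_mem_supported k _ ⟨hc.cons_mem hw.1 h, ?_⟩
    rw [vertexPart_cons (hc.not_mem hw.1 h)]
    exact hw.2
  · rw [coneOp_single_of_not_nonempty k c h]
    exact zero_mem _

/-- For a tuple $w$ with cone point $z$, the cone identity leaves $z*\partial w$ minus the coned
faces of $w$. A face with the same vertices in `P` has the same cone point and cancels; every other
face has fewer such vertices, and neither cone point lies in `P`. -/
lemma coneOp_lowers_filtration (hc : IsConing P L c) {n m : ℕ} {w : (Fin (n + 1) → V) →₀ k}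
    (hw : w ∈ partFiltration P k L (m + 1) (n + 1)) :
    w - tbd k (n + 1) (coneOp P k c (n + 1) w) - coneOp P k c n (tbd k n w) ∈
      partFiltration P k L m (n + 1) := by
  refine linearMap_mem_of_supported k (LinearMap.id - tbd k (n + 1) ∘ₗ coneOp P k c (n + 1) -
    coneOp P k c n ∘ₗ tbd k n) (fun w hw => ?_) hw
  simp only [LinearMap.sub_apply, LinearMap.id_apply, LinearMap.comp_apply]
  by_cases h : (vertexPart P w).Nonempty
  · rw [coneOp_single_of_nonempty k c h, ← tcone_single, tbd_tcone, sub_sub_cancel, tbd_single,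
      map_sum, map_sum, ← Finset.sum_sub_distrib]
    refine Submodule.sum_mem _ fun i _ => ?_
    rw [map_smul, map_smul, ← smul_sub]
    refine Submodule.smul_mem _ _ ?_
    by_cases hi : vertexPart P (w ∘ i.succAbove) = vertexPart P w
    · rw [coneOp_single_of_nonempty k c (hi ▸ h), tcone_single, hi, sub_self]
      exact zero_mem _
    have hlt : (vertexPart P (w ∘ i.succAbove)).card ≤ m :=
      Nat.lt_succ_iff.1 ((Finset.card_lt_card
        ((vertexPart_comp_subset w _).ssubset_of_ne hi)).trans_le hw.2)
    refine sub_mem ?_ ?_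
    · rw [tcone_single]
      refine Finsupp.single_mem_supported k _ ⟨?_, ?_⟩
      · have := tuplesOf_comp (hc.cons_mem hw.1 h) i.succ.succAbove
        rwa [cons_comp_succAbove_succ] at this
      · rwa [vertexPart_cons (hc.not_mem hw.1 h)]
    · rcases n with _ | n
      · rw [coneOp_single_of_not_nonempty]
        · exact zero_mem _
        · rintro ⟨v, hv⟩
          obtain ⟨⟨j, -⟩, -⟩ := mem_vertexPart.1 hv
          exact j.elim0
      · exact coneOp_mem k hc (Finsupp.single_mem_supported k _ ⟨tuplesOf_comp hw.1 _, hlt⟩)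
  · rw [coneOp_single_of_not_nonempty k c h, map_zero, sub_zero, tbd_single, map_sum,
      Finset.sum_eq_zero, sub_zero]
    · refine Finsupp.single_mem_supported k _ ⟨hw.1, ?_⟩
      rw [Finset.not_nonempty_iff_eq_empty] at h
      simp [h]
    · intro i _
      rw [map_smul, coneOp_single_of_not_nonempty, smul_zero]
      exact fun h' => h (h'.mono (vertexPart_comp_subset w _))

/-- Subtracting the boundary of the coned chain does not change the boundary of `w`, so the
hypothesis `h` persists and the filtration can be lowered down to zero. -/
lemma exists_sub_tbd_mem (hc : IsConing P L c) {n : ℕ} (m : ℕ) (w : (Fin (n + 1) → V) →₀ k)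
    (hw : w ∈ partFiltration P k L m (n + 1)) (h : coneOp P k c n (tbd k n w) = 0) :
    ∃ b ∈ partFiltration P k L m (n + 2), w - tbd k (n + 1) b ∈ partFiltration P k L 0 (n + 1) := by
  induction m generalizing w with
  | zero => exact ⟨0, zero_mem _, by simpa using hw⟩
  | succ m ih =>
    have h1 := coneOp_lowers_filtration k hc hw
    rw [h, sub_zero] at h1
    obtain ⟨b, hb, hb'⟩ := ih _ h1 (by rw [map_sub, tbd_tbd, sub_zero, h])
    refine ⟨coneOp P k c _ w + b, add_mem (coneOp_mem k hc hw) ?_, ?_⟩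
    · refine Finsupp.supported_mono ?_ hb
      exact fun w hw => ⟨hw.1, hw.2.trans (Nat.le_succ m)⟩
    · rwa [map_add, ← sub_sub]

/-- The tuple of vertices of a simplex. -/
def vertices {L : PreAbstractSimplicialComplex V} {n : ℕ} (x : (toSSet L) _⦋n⦌) : Fin (n + 1) → V :=
  x.1

lemma vertices_injective (n : ℕ) : Function.Injective (vertices (L := L) (n := n)) :=
  Subtype.val_injective

lemma range_vertices (n : ℕ) : Set.range (vertices (L := L) (n := n)) = tuplesOf L (n + 1) :=
  Subtype.range_val

/-- The tuple chains of the simplicial set of a simplicial complex. -/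
def toTuples (L : PreAbstractSimplicialComplex V) (n : ℕ) :
    ((toSSet L) _⦋n⦌ →₀ k) →ₗ[k] ((Fin (n + 1) → V) →₀ k) :=
  Finsupp.lmapDomain k k vertices

lemma toTuples_single (n : ℕ) (x : (toSSet L) _⦋n⦌) (a : k) :
    toTuples k L n (Finsupp.single x a) = Finsupp.single (vertices x) a :=
  Finsupp.mapDomain_single

lemma range_toTuples (n : ℕ) :
    LinearMap.range (toTuples k L n) = Finsupp.supported k k (tuplesOf L (n + 1)) := by
  rw [LinearMap.range_eq_map, ← Finsupp.supported_univ, toTuples, Finsupp.lmapDomain_supported,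
    Set.image_univ, range_vertices]

lemma tbd_toTuples (n : ℕ) (a : (toSSet L) _⦋n + 1⦌ →₀ k) :
    tbd k (n + 1) (toTuples k L (n + 1) a) = toTuples k L n (bd k _ n a) := by
  induction a using Finsupp.induction_linear with
  | zero => simp
  | add f g hf hg => simp only [map_add, hf, hg]
  | single x a =>
    simp only [bd_single, map_sum, map_smul, toTuples_single, tbd_single]
    rfl

/-- The inclusion of simplicial sets induced by an inclusion of simplicial complexes. -/
abbrev inclSSet (h : K ≤ L) : toSSet K ⟶ toSSet L := (toSSetFunctor V).map (homOfLE h)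

lemma toTuples_mem_iff (n : ℕ) (h : K ≤ L) (a : (toSSet L) _⦋n⦌ →₀ k) :
    a ∈ imChains k (inclSSet h) n ↔
      toTuples k L n a ∈ Finsupp.supported k k (tuplesOf K (n + 1)) := by
  classical
  have h1 : Set.range ((inclSSet h).app (Opposite.op ⦋n⦌)) =
      vertices ⁻¹' (tuplesOf K (n + 1)) := by
    ext x
    constructor
    · rintro ⟨y, rfl⟩
      exact y.2
    · intro hx
      exact ⟨⟨vertices x, hx⟩, rfl⟩
  rw [imChains, h1, Finsupp.mem_supported k (toTuples k L n a), toTuples,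
    Finsupp.lmapDomain_apply, Finsupp.mapDomain_support_of_injective (vertices_injective n),
    Finset.coe_image, Set.image_subset_iff]
  rfl

instance mono_toSSetFunctor_map (h : K ⟶ L) : Mono ((toSSetFunctor V).map h) := by
  have (n : SimplexCategoryᵒᵖ) : Mono (((toSSetFunctor V).map h).app n) := by
    rw [mono_iff_injective]
    intro x y hxy
    exact Subtype.ext (congrArg (fun z : (toSSet L).obj n => z.1) hxy)
  exact NatTrans.mono_of_mono_app _

instance mono_inclSSet (h : K ≤ L) : Mono (inclSSet h) :=
  mono_toSSetFunctor_map (homOfLE h)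

/-- A relative cycle has its boundary in `K`, where no vertex satisfies `P`; the cone operator kills
that boundary, and the cycle can be pushed into `K` by iterated coning. -/
theorem hIso_of_coning (hKL : K ≤ L) (hc : IsConing P L c)
    (hK : ∀ σ ∈ L, (∀ v ∈ σ, ¬ P v) → σ ∈ K) (hKP : ∀ σ ∈ K, ∀ v ∈ σ, ¬ P v) :
    HIso k (inclSSet hKL) := by
  have key (n : ℕ) (a : (toSSet L) _⦋n⦌ →₀ k) (h : coneOp P k c n (tbd k n (toTuples k L n a)) = 0) :
      ∃ b, a - bd k (toSSet L) n b ∈ imChains k (inclSSet hKL) n := by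
    -- The iteration starts at `n + 1`, the length of the tuples, which bounds the number of their
    -- vertices.
    have ha : toTuples k L n a ∈ partFiltration P k L (n + 1) (n + 1) := by
      have h1 : toTuples k L n a ∈ Finsupp.supported k k (tuplesOf L (n + 1)) := by
        rw [← range_toTuples]
        exact ⟨a, rfl⟩
      have h2 : tuplesOf L (n + 1) ⊆
          {w | w ∈ tuplesOf L (n + 1) ∧ (vertexPart P w).card ≤ n + 1} := fun w hw => by
        classical
        refine ⟨hw, (Finset.card_filter_le _ _).trans (Finset.card_image_le.trans ?_)⟩
        simp
      exact Finsupp.supported_mono h2 h1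
    obtain ⟨b, hb, hb'⟩ := exists_sub_tbd_mem k hc _ _ ha h
    obtain ⟨b, rfl⟩ : b ∈ LinearMap.range (toTuples k L (n + 1)) := by
      rw [range_toTuples]
      have h2 : {w | w ∈ tuplesOf L (n + 2) ∧ (vertexPart P w).card ≤ n + 1} ⊆
          tuplesOf L (n + 2) := fun w hw => hw.1
      exact Finsupp.supported_mono h2 hb
    refine ⟨b, ?_⟩
    rw [toTuples_mem_iff, map_sub, ← tbd_toTuples]
    suffices h2 : {w | w ∈ tuplesOf L (n + 1) ∧ (vertexPart P w).card ≤ 0} ⊆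
      tuplesOf K (n + 1) from Finsupp.supported_mono h2 hb'
    refine fun w hw => hK _ hw.1 fun v hv hPv => ?_
    have h0 := Finset.card_eq_zero.1 (Nat.le_zero.1 hw.2)
    replace hv : ∃ i, w i = v := by simpa using hv
    exact Finset.notMem_empty v (h0 ▸ mem_vertexPart.2 ⟨hv, hPv⟩)
  apply quasiIso_of_chains
  -- In degree zero the augmented boundary is supported on the empty tuple, which has no vertex to
  -- cone off.
  · intro a
    refine key 0 a ?_
    have : tbd k 0 (toTuples k L 0 a) ∈ Finsupp.supported k k Set.univ := by
      rw [Finsupp.supported_univ]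
      trivial
    refine (Submodule.mem_bot k).1 (linearMap_mem_of_supported k _ (fun w _ => ?_) this)
    rw [Submodule.mem_bot]
    refine coneOp_single_of_not_nonempty k c ?_
    rintro ⟨v, hv⟩
    obtain ⟨⟨j, -⟩, -⟩ := mem_vertexPart.1 hv
    exact j.elim0
  · intro n a ha
    refine key (n + 1) a ?_
    replace ha := (toTuples_mem_iff k n hKL _).1 ha
    erw [← tbd_toTuples] at ha
    refine (Submodule.mem_bot k).1 (linearMap_mem_of_supported k _ (fun w hw => ?_) ha)
    rw [Submodule.mem_bot]
    refine coneOp_single_of_not_nonempty k c ?_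
    rintro ⟨v, hv⟩
    obtain ⟨hv, hPv⟩ := mem_vertexPart.1 hv
    exact hKP _ hw v (by simpa using hv) hPv

end Cone

/-! ### Vertex maps and families of simplicial complexes. -/

section VertexMaps

variable {V V' : Type} {K L : PreAbstractSimplicialComplex V}
  {K' L' : PreAbstractSimplicialComplex V'}

/-- A vertex map sends simplices of `K` to simplices of `K'`. -/
def IsVertexMap (K : PreAbstractSimplicialComplex V) (K' : PreAbstractSimplicialComplex V')
    (g : V → V') : Prop :=
  ∀ σ ∈ K, ∀ τ : Finset V', (∀ v', v' ∈ τ ↔ ∃ v ∈ σ, g v = v') → τ ∈ K'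

/-- The map of simplicial sets induced by a vertex map. -/
def vertexMap {g : V → V'} (hg : IsVertexMap K K' g) : toSSet K ⟶ toSSet K' where
  app n := TypeCat.ofHom fun f => ⟨g ∘ f.1, by
    classical
    exact hg _ f.2 _ (by simp)⟩

lemma isIso_vertexMap {g : V → V'} (hg : IsVertexMap K K' g) (hinj : Function.Injective g)
    (hK : ∀ σ ∈ K', ∀ v ∈ σ, v ∈ Set.range g)
    (hK' : ∀ (σ : Finset V), ∀ τ ∈ K', (∀ v', v' ∈ τ ↔ ∃ v ∈ σ, g v = v') → σ ∈ K) :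
    IsIso (vertexMap hg) := by
  classical
  rw [NatTrans.isIso_iff_isIso_app]
  intro n
  rw [isIso_iff_bijective]
  constructor
  · intro x y hxy
    refine Subtype.ext (hinj.comp_left (congrArg Subtype.val hxy))
  · intro y
    choose f hf using fun i => hK _ y.2 (y.1 i) (Finset.mem_image_of_mem _ (Finset.mem_univ i))
    refine ⟨⟨f, hK' _ _ y.2 ?_⟩, Subtype.ext (funext hf)⟩
    simp [hf]

variable {T : Type} [Preorder T]

/-- The functor to simplicial sets given by a monotone family of simplicial complexes. -/
abbrev cxFunctor {K : T → PreAbstractSimplicialComplex V} (hK : Monotone K) : T ⥤ SSet.{0} :=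
  hK.functor ⋙ toSSetFunctor V

/-- The natural transformation given by a vertex map. -/
def vertexMapNat {K : T → PreAbstractSimplicialComplex V} (hK : Monotone K)
    {K' : T → PreAbstractSimplicialComplex V'} (hK' : Monotone K') {g : V → V'}
    (hg : ∀ t, IsVertexMap (K t) (K' t) g) : cxFunctor hK ⟶ cxFunctor hK' where
  app t := vertexMap (hg t)

/-- The natural transformation given by inclusions. -/
def inclNat {K : T → PreAbstractSimplicialComplex V} (hK : Monotone K)
    {K' : T → PreAbstractSimplicialComplex V} (hK' : Monotone K')
    (h : ∀ t, K t ≤ K' t) : cxFunctor hK ⟶ cxFunctor hK' where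
  app t := inclSSet (h t)

variable (k : Type u) [Field k]

/-- The cone point has to serve all simplices `ρ` sharing the `P`-vertices of `σ`, so it can be
chosen as a function of these vertices alone. -/
lemma hIso_of_exists_cone {P : V → Prop} (hKL : K ≤ L)
    (hc : ∀ σ ∈ L, (∃ v ∈ σ, P v) → ∃ z, ¬ P z ∧ ∀ ρ ∈ L, (∀ v, P v → (v ∈ ρ ↔ v ∈ σ)) →
      ∀ τ : Finset V, (∀ v, v ∈ τ ↔ v = z ∨ v ∈ ρ) → τ ∈ L)
    (hK : ∀ σ ∈ L, (∀ v ∈ σ, ¬ P v) → σ ∈ K) (hKP : ∀ σ ∈ K, ∀ v ∈ σ, ¬ P v) :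
    HIso k (inclSSet hKL) := by
  classical
  rcases isEmpty_or_nonempty V with hV | ⟨⟨v₀⟩⟩
  · have : IsIso (inclSSet hKL) := by
      rw [NatTrans.isIso_iff_isIso_app]
      intro n
      rw [isIso_iff_bijective]
      exact ⟨fun x => hV.elim (x.1 0), fun x => hV.elim (x.1 0)⟩
    exact hIso_of_isIso k _
  · have h (τ : Finset V) : ∃ z, ∀ ρ ∈ L, ρ.filter P = τ → τ.Nonempty → ¬ P z ∧ insert z ρ ∈ L := by
      by_cases hτ : ∃ σ ∈ L, σ.filter P = τ ∧ τ.Nonempty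
      · obtain ⟨σ, hσ, rfl, v, hv⟩ := hτ
        obtain ⟨z, hz, h⟩ := hc σ hσ ⟨v, (Finset.mem_filter.1 hv).1, (Finset.mem_filter.1 hv).2⟩
        exact ⟨z, fun ρ hρ hρσ _ => ⟨hz, h ρ hρ (fun v hv => by
          have := Finset.ext_iff.1 hρσ v
          simpa [hv] using this) _ (by simp)⟩⟩
      -- A default vertex for sets that are not the `P`-part of any simplex.
      · exact ⟨v₀, fun ρ hρ hρτ hn => (hτ ⟨ρ, hρ, hρτ, hn⟩).elim⟩
    choose c hc using h
    exact hIso_of_coning k (c := c) hKL (fun σ hσ hn => hc _ σ hσ rfl hn) hK hKP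

end VertexMaps

/-! ### Dowker duality for pairs of relations. -/

section Dowker

variable {Z Y : Type}

/-- The nerve of a relation. -/
def nerveOf (R : Z → Y → Prop) : PreAbstractSimplicialComplex Z where
  faces := {σ | σ.Nonempty ∧ ∃ y, ∀ z ∈ σ, R z y}
  isRelLowerSet_faces := by
    rintro σ ⟨hσ, y, hy⟩
    exact ⟨hσ, fun τ hτσ hτ => ⟨hτ, y, fun x hx => hy x (hτσ hx)⟩⟩

lemma nerveOf_mono {R R' : Z → Y → Prop} (h : R ≤ R') : nerveOf R ≤ nerveOf R' := by
  rintro σ ⟨hσ, y, hy⟩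
  exact ⟨hσ, y, fun z hz => h z y (hy z hz)⟩

/-- The complex on the disjoint union of the vertices of both nerves of a relation. -/
def joinComplex (R : Z → Y → Prop) : PreAbstractSimplicialComplex (Z ⊕ Y) where
  faces := {σ | σ.Nonempty ∧ (∃ y, ∀ z, Sum.inl z ∈ σ → R z y) ∧
    (∃ z, ∀ y, Sum.inr y ∈ σ → R z y) ∧ ∀ z y, Sum.inl z ∈ σ → Sum.inr y ∈ σ → R z y}
  isRelLowerSet_faces := by
    rintro σ ⟨hσ, ⟨y, hy⟩, ⟨z, hz⟩, h⟩
    exact ⟨hσ, fun τ hτσ hτ => ⟨hτ, ⟨y, fun z hz => hy z (hτσ hz)⟩, ⟨z, fun y hy => hz y (hτσ hy)⟩,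
      fun z y hz hy => h z y (hτσ hz) (hτσ hy)⟩⟩

lemma joinComplex_mono {R R' : Z → Y → Prop} (h : R ≤ R') : joinComplex R ≤ joinComplex R' := by
  rintro σ ⟨hσ, ⟨y, hy⟩, ⟨z, hz⟩, hR⟩
  exact ⟨hσ, ⟨y, fun z hz => h _ _ (hy z hz)⟩, ⟨z, fun y hy => h _ _ (hz y hy)⟩,
    fun z y hz hy => h _ _ (hR z y hz hy)⟩

/-- The subcomplex of simplices whose vertices do not satisfy `P`. -/
def avoiding {V : Type} (L : PreAbstractSimplicialComplex V) (P : V → Prop) :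
    PreAbstractSimplicialComplex V where
  faces := {σ | σ ∈ L ∧ ∀ v ∈ σ, ¬ P v}
  isRelLowerSet_faces := by
    rintro σ ⟨hσ, h⟩
    exact ⟨(L.isRelLowerSet_faces hσ).1, fun τ hτσ hτ =>
      ⟨(L.isRelLowerSet_faces hσ).2 hτσ hτ, fun v hv => h v (hτσ hv)⟩⟩

lemma avoiding_le {V : Type} (L : PreAbstractSimplicialComplex V) (P : V → Prop) :
    avoiding L P ≤ L := fun _ h => h.1

lemma isVertexMap_inl (R : Z → Y → Prop) : IsVertexMap (nerveOf R) (joinComplex R) Sum.inl := by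
  rintro σ ⟨⟨z, hz⟩, y, hy⟩ τ hτ
  have h₁ (z : Z) : Sum.inl z ∈ τ ↔ z ∈ σ := by simp [hτ]
  have h₂ (y : Y) : Sum.inr y ∉ τ := by simp [hτ]
  exact ⟨⟨_, (h₁ z).2 hz⟩, ⟨y, fun z hz => hy z ((h₁ z).1 hz)⟩,
    ⟨z, fun y hy => (h₂ y hy).elim⟩, fun z y _ hy => (h₂ y hy).elim⟩

lemma isVertexMap_inr (R : Z → Y → Prop) :
    IsVertexMap (nerveOf fun y z => R z y) (joinComplex R) Sum.inr := by
  rintro σ ⟨⟨y, hy⟩, z, hz⟩ τ hτ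
  have h₁ (y : Y) : Sum.inr y ∈ τ ↔ y ∈ σ := by simp [hτ]
  have h₂ (z : Z) : Sum.inl z ∉ τ := by simp [hτ]
  exact ⟨⟨_, (h₁ y).2 hy⟩, ⟨y, fun z hz => (h₂ z hz).elim⟩,
    ⟨z, fun y hy => hz y ((h₁ y).1 hy)⟩, fun z y hz _ => (h₂ z hz).elim⟩

variable (k : Type u) [Field k]

/-- The nerve is the full subcomplex of `joinComplex R` on the left vertices. A simplex with a right
vertex is coned off by an element of `Z` related to all its right vertices. The cone is again a
simplex, since any right vertex witnesses the condition on the left ones. -/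
theorem hIso_inl (R : Z → Y → Prop) : HIso k (vertexMap (isVertexMap_inl R)) := by
  have h₁ : IsVertexMap (nerveOf R) (avoiding (joinComplex R) fun v => v.isRight) Sum.inl :=
    fun σ hσ τ hτ => ⟨isVertexMap_inl R σ hσ τ hτ, by simp [hτ]⟩
  have := isIso_vertexMap h₁ Sum.inl_injective
    (by rintro σ ⟨hσ, h⟩ (z | y) hv; exacts [⟨z, rfl⟩, (h _ hv rfl).elim])
    (by
      rintro σ τ ⟨⟨⟨v, hv⟩, ⟨y, hy⟩, -⟩, -⟩ hτ
      obtain ⟨z, hz, -⟩ := (hτ _).1 hv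
      exact ⟨⟨z, hz⟩, y, fun z hz => hy z ((hτ _).2 ⟨z, hz, rfl⟩)⟩)
  refine hIso_comp k (f := vertexMap h₁) (g := inclSSet (avoiding_le _ _)) (hIso_of_isIso k _)
    (hIso_of_exists_cone k (P := fun v => v.isRight) _ ?_ (fun σ hσ h => ⟨hσ, h⟩) fun σ hσ => hσ.2)
  rintro σ ⟨-, -, ⟨z, hz⟩, -⟩ ⟨v, hv, hvP⟩
  refine ⟨Sum.inl z, by simp, ?_⟩
  rintro ρ ⟨-, -, -, hρ⟩ hρσ τ hτ
  obtain ⟨y, rfl⟩ := Sum.isRight_iff.1 hvP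
  have key (z' : Z) (y' : Y) (h1 : Sum.inl z' ∈ τ) (h2 : Sum.inr y' ∈ τ) : R z' y' := by
    simp only [hτ, Sum.inl.injEq, reduceCtorEq, false_or] at h1 h2
    rcases h1 with rfl | h1
    · exact hz _ ((hρσ _ rfl).1 h2)
    · exact hρ _ _ h1 h2
  have hz' : Sum.inl z ∈ τ := (hτ _).2 (Or.inl rfl)
  exact ⟨⟨_, hz'⟩, ⟨y, fun z' hz' => key z' y hz' ((hτ _).2 (Or.inr ((hρσ _ rfl).2 hv)))⟩,
    ⟨z, fun y' hy' => key z y' hz' hy'⟩, key⟩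

theorem hIso_inr (R : Z → Y → Prop) : HIso k (vertexMap (isVertexMap_inr R)) := by
  have h₁ : IsVertexMap (nerveOf fun y z => R z y) (avoiding (joinComplex R) fun v => v.isLeft)
      Sum.inr := fun σ hσ τ hτ => ⟨isVertexMap_inr R σ hσ τ hτ, by simp [hτ]⟩
  have := isIso_vertexMap h₁ Sum.inr_injective
    (by rintro σ ⟨hσ, h⟩ (z | y) hv; exacts [(h _ hv rfl).elim, ⟨y, rfl⟩])
    (by
      rintro σ τ ⟨⟨⟨v, hv⟩, -, ⟨z, hz⟩, -⟩, -⟩ hτ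
      obtain ⟨y, hy, -⟩ := (hτ _).1 hv
      exact ⟨⟨y, hy⟩, z, fun y hy => hz y ((hτ _).2 ⟨y, hy, rfl⟩)⟩)
  refine hIso_comp k (f := vertexMap h₁) (g := inclSSet (avoiding_le _ _)) (hIso_of_isIso k _)
    (hIso_of_exists_cone k (P := fun v => v.isLeft) _ ?_ (fun σ hσ h => ⟨hσ, h⟩) fun σ hσ => hσ.2)
  rintro σ ⟨-, ⟨y, hy⟩, -, -⟩ ⟨v, hv, hvP⟩
  refine ⟨Sum.inr y, by simp, ?_⟩
  rintro ρ ⟨-, -, -, hρ⟩ hρσ τ hτ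
  obtain ⟨z, rfl⟩ := Sum.isLeft_iff.1 hvP
  have key (z' : Z) (y' : Y) (h1 : Sum.inl z' ∈ τ) (h2 : Sum.inr y' ∈ τ) : R z' y' := by
    simp only [hτ, Sum.inr.injEq, reduceCtorEq, false_or] at h1 h2
    rcases h2 with rfl | h2
    · exact hy _ ((hρσ _ rfl).1 h1)
    · exact hρ _ _ h1 h2
  have hy' : Sum.inr y ∈ τ := (hτ _).2 (Or.inl rfl)
  exact ⟨⟨_, hy'⟩, ⟨y, fun z' hz' => key z' y hz' hy'⟩,
    ⟨z, fun y' hy' => key z y' ((hτ _).2 (Or.inr ((hρσ _ rfl).2 hv))) hy'⟩, key⟩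

/-- The nerves of a monotone family of relations. -/
abbrev nerveFunctor {T : Type} [Preorder T] {R : T → Z → Y → Prop} (hR : Monotone R) :
    T ⥤ SSet.{0} :=
  cxFunctor (K := fun t => nerveOf (R t)) fun _ _ hab => nerveOf_mono (hR hab)

/-- The inclusion of the nerves of one family of relations into those of another. -/
abbrev nerveIncl {T : Type} [Preorder T] {R R' : T → Z → Y → Prop} (hR : Monotone R)
    (hR' : Monotone R') (h : ∀ t, R t ≤ R' t) : nerveFunctor hR ⟶ nerveFunctor hR' :=
  inclNat _ _ fun t => nerveOf_mono (h t)

lemma monotone_flip {T : Type} [Preorder T] {R : T → Z → Y → Prop} (hR : Monotone R) :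
    Monotone fun t y z => R t z y :=
  fun _ _ hab y z => hR hab z y

/-- Both nerves include into the join complex by homology isomorphisms, and the join complex is
monotone in the relation, so the zigzag is natural for families and pairs. -/
lemma relH_iso_dowker {T : Type} [Preorder T] {R R' : T → Z → Y → Prop} (hR : Monotone R)
    (hR' : Monotone R') (h : ∀ t, R t ≤ R' t) (n : ℕ) :
    Nonempty (arrowFunctor (nerveIncl hR hR' h) ⋙ relH k n ≅
      arrowFunctor (nerveIncl (monotone_flip hR) (monotone_flip hR') fun t y z => h t z y) ⋙
        relH k n) := by
  have hJ : Monotone fun t => joinComplex (R t) := fun _ _ hab => joinComplex_mono (hR hab)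
  have hJ' : Monotone fun t => joinComplex (R' t) := fun _ _ hab => joinComplex_mono (hR' hab)
  have hm (t : T) : Mono ((inclNat hJ hJ' fun t => joinComplex_mono (h t)).app t) :=
    mono_inclSSet (joinComplex_mono (h t))
  obtain ⟨e₁⟩ := relH_iso (k := k) (α := nerveIncl hR hR' h)
    (α' := inclNat hJ hJ' fun t => joinComplex_mono (h t))
    (vertexMapNat _ hJ fun t => isVertexMap_inl (R t))
    (vertexMapNat _ hJ' fun t => isVertexMap_inl (R' t)) rfl
    (fun t => mono_inclSSet (nerveOf_mono (h t))) hm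
    (fun t => hIso_inl k (R t)) (fun t => hIso_inl k (R' t)) n
  obtain ⟨e₂⟩ := relH_iso (k := k)
    (α := nerveIncl (monotone_flip hR) (monotone_flip hR') fun t y z => h t z y)
    (α' := inclNat hJ hJ' fun t => joinComplex_mono (h t))
    (vertexMapNat _ hJ fun t => isVertexMap_inr (R t))
    (vertexMapNat _ hJ' fun t => isVertexMap_inr (R' t)) rfl
    (fun t => mono_inclSSet (nerveOf_mono fun y z => h t z y)) hm
    (fun t => hIso_inr k (R t)) (fun t => hIso_inr k (R' t)) n
  exact ⟨e₁ ≪≫ e₂.symm⟩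

end Dowker

/-! ### Singular simplices contained in one convex cell, compared with their vertex tuples. -/

section Singular

/-- The singular simplicial set of a topological space. -/
abbrev Sing (E : Type) [TopologicalSpace E] : SSet.{0} := TopCat.toSSet.obj (TopCat.of E)

section

variable {E : Type} [TopologicalSpace E]

/-- The continuous map underlying a singular simplex. -/
abbrev singMap {n : SimplexCategoryᵒᵖ} (σ : (Sing E).obj n) :
    C(stdSimplex ℝ (Fin (n.unop.len + 1)), E) :=
  (TopCat.of E).toSSetObjEquiv n σ

lemma singMap_map {m n : SimplexCategoryᵒᵖ} (f : m ⟶ n) (σ : (Sing E).obj m)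
    (w : stdSimplex ℝ (Fin (n.unop.len + 1))) :
    singMap ((Sing E).map f σ) w = singMap σ (stdSimplex.map f.unop w) := rfl

lemma sing_ext {n : SimplexCategoryᵒᵖ} {σ τ : (Sing E).obj n}
    (h : ∀ w, singMap σ w = singMap τ w) : σ = τ :=
  ((TopCat.of E).toSSetObjEquiv n).injective (ContinuousMap.ext h)

/-- The singular simplices with image in `A`. -/
def singOf (A : Set E) : (Sing E).Subcomplex where
  obj _ := {σ | ∀ w, singMap σ w ∈ A}
  map _ _ hσ _ := hσ _

/-- The singular simplices whose image is related to one element. -/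
def singSmall {Z : Type} (R : Z → E → Prop) : (Sing E).Subcomplex where
  obj _ := {σ | ∃ z, ∀ w, R z (singMap σ w)}
  map _ _ := fun ⟨z, hz⟩ => ⟨z, fun _ => hz _⟩

lemma singSmall_mono {Z : Type} {R R' : Z → E → Prop} (h : R ≤ R') :
    singSmall R ≤ singSmall R' :=
  fun _ _ ⟨z, hz⟩ => ⟨z, fun w => h _ _ (hz w)⟩

lemma singSmall_le {Z : Type} (R : Z → E → Prop) : singSmall R ≤ singOf {y | ∃ z, R z y} :=
  fun _ _ ⟨z, hz⟩ w => ⟨z, hz w⟩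

lemma singOf_mono {A B : Set E} (h : A ⊆ B) : singOf A ≤ singOf B :=
  fun _ _ hσ w => h (hσ w)

end

section Affine

variable {E : Type} [NormedAddCommGroup E] [NormedSpace ℝ E]

lemma sum_stdSimplex_map {n m : ℕ} (f : Fin m → Fin n) (p : Fin n → E)
    (w : stdSimplex ℝ (Fin m)) :
    ∑ i, stdSimplex.map f w i • p i = ∑ j, w j • p (f j) := by
  classical
  simp only [stdSimplex.map_coe, FunOnFinite.linearMap_apply_apply, Finset.sum_smul]
  rw [← Finset.sum_fiberwise Finset.univ f fun j => w j • p (f j)]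
  refine Finset.sum_congr rfl fun i _ => Finset.sum_congr rfl fun j hj => ?_
  rw [(Finset.mem_filter.1 hj).2]

/-- The affine singular simplex with given vertices. -/
def affineMap {n : ℕ} (p : Fin n → E) : C(stdSimplex ℝ (Fin n), E) where
  toFun w := ∑ i, w i • p i
  continuous_toFun := by
    refine continuous_finsetSum _ fun i _ => Continuous.smul ?_ continuous_const
    exact (continuous_apply i).comp continuous_subtype_val

lemma affineMap_vertex {n : ℕ} (p : Fin n → E) (i : Fin n) :
    affineMap p (stdSimplex.vertex i) = p i := by
  simp [affineMap, Pi.single_apply]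

lemma affineMap_map {n m : ℕ} (f : Fin m → Fin n) (p : Fin n → E) (w : stdSimplex ℝ (Fin m)) :
    affineMap p (stdSimplex.map f w) = affineMap (p ∘ f) w :=
  sum_stdSimplex_map f p w

lemma affineMap_mem {n : ℕ} {A : Set E} (hA : Convex ℝ A) {p : Fin n → E} (hp : ∀ i, p i ∈ A)
    (w : stdSimplex ℝ (Fin n)) : affineMap p w ∈ A :=
  hA.sum_mem (fun i _ => w.2.1 i) w.2.2 fun i _ => hp i

/-- The affine singular simplex with given vertices, as a simplex. -/
def affineSing {n : SimplexCategoryᵒᵖ} (p : Fin (n.unop.len + 1) → E) : (Sing E).obj n :=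
  ((TopCat.of E).toSSetObjEquiv n).symm (affineMap p)

lemma singMap_affineSing {n : SimplexCategoryᵒᵖ} (p : Fin (n.unop.len + 1) → E) :
    singMap (affineSing p) = affineMap p :=
  Equiv.apply_symm_apply _ _

lemma map_affineSing {m n : SimplexCategoryᵒᵖ} (f : m ⟶ n) (p : Fin (m.unop.len + 1) → E) :
    (Sing E).map f (affineSing p) = affineSing (p ∘ f.unop.toOrderHom) := by
  refine sing_ext fun w => ?_
  rw [singMap_map, singMap_affineSing, singMap_affineSing]
  exact affineMap_map _ p w

variable {Z : Type} {R : Z → E → Prop}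

/-- The vertices of small singular simplices. -/
def toVertices (R : Z → E → Prop) : (singSmall R : SSet.{0}) ⟶ toSSet (nerveOf fun y z => R z y) where
  app n := TypeCat.ofHom fun σ => ⟨fun i => singMap σ.1 (stdSimplex.vertex i), by
    classical
    obtain ⟨z, hz⟩ := σ.2
    exact ⟨Finset.univ_nonempty.image _, z, by simpa using fun i => hz _⟩⟩
  naturality m n f := by
    ext σ
    refine Subtype.ext (funext fun i => ?_)
    exact congrArg (singMap σ.1) (stdSimplex.map_vertex _ i)

/-- Affine singular simplices with vertices in a common convex set. -/
def ofVertices (hR : ∀ z, Convex ℝ {y | R z y}) :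
    toSSet (nerveOf fun y z => R z y) ⟶ (singSmall R : SSet.{0}) where
  app n := TypeCat.ofHom fun p => ⟨affineSing p.1, by
    obtain ⟨-, z, hz⟩ := p.2
    refine ⟨z, fun w => ?_⟩
    rw [singMap_affineSing]
    exact affineMap_mem (hR z) (fun i => hz _ (by simp)) w⟩
  naturality m n f := by
    ext p
    exact Subtype.ext (map_affineSing f p.1).symm

lemma ofVertices_toVertices (hR : ∀ z, Convex ℝ {y | R z y}) :
    ofVertices hR ≫ toVertices R = 𝟙 _ := by
  ext n p
  refine Subtype.ext (funext fun i => ?_)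
  change singMap (affineSing p.1) _ = _
  rw [singMap_affineSing, affineMap_vertex]
  rfl

/-- The vertices of a simplex of `Δ[1]`, as real numbers. -/
def bit {n : SimplexCategoryᵒᵖ} (τ : (Δ[1] : SSet.{0}).obj n) (i : Fin (n.unop.len + 1)) : ℝ :=
  (((SSet.stdSimplex.objEquiv τ).toOrderHom i : Fin 2) : ℕ)

/-- The sum of the barycentric coordinates belonging to the vertex `1` of a simplex of `Δ[1]`. -/
def weight {n : SimplexCategoryᵒᵖ} (τ : (Δ[1] : SSet.{0}).obj n) :
    C(stdSimplex ℝ (Fin (n.unop.len + 1)), ℝ) :=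
  affineMap (bit τ)

lemma weight_map {m n : SimplexCategoryᵒᵖ} (f : m ⟶ n) (τ : (Δ[1] : SSet.{0}).obj m)
    (w : stdSimplex ℝ (Fin (n.unop.len + 1))) :
    weight ((Δ[1] : SSet.{0}).map f τ) w = weight τ (stdSimplex.map f.unop w) :=
  (affineMap_map _ (bit τ) w).symm

lemma weight_mem {n : SimplexCategoryᵒᵖ} (τ : (Δ[1] : SSet.{0}).obj n)
    (w : stdSimplex ℝ (Fin (n.unop.len + 1))) : weight τ w ∈ Set.Icc (0 : ℝ) 1 := by
  refine affineMap_mem (convex_Icc 0 1) (fun i => ⟨Nat.cast_nonneg _, ?_⟩) w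
  exact_mod_cast Nat.lt_succ_iff.1 ((SSet.stdSimplex.objEquiv τ).toOrderHom i).2

/-- The straight line from the affine simplex to the given simplex, with parameter `weight τ`. -/
def lineSing {n : SimplexCategoryᵒᵖ} (σ : (Sing E).obj n) (τ : (Δ[1] : SSet.{0}).obj n) :
    (Sing E).obj n :=
  ((TopCat.of E).toSSetObjEquiv n).symm
    ((1 - weight τ) • affineMap (fun i => singMap σ (stdSimplex.vertex i)) + weight τ • singMap σ)

lemma singMap_lineSing {n : SimplexCategoryᵒᵖ} (σ : (Sing E).obj n) (τ : (Δ[1] : SSet.{0}).obj n)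
    (w : stdSimplex ℝ (Fin (n.unop.len + 1))) : singMap (lineSing σ τ) w =
      (1 - weight τ w) • affineMap (fun i => singMap σ (stdSimplex.vertex i)) w +
        weight τ w • singMap σ w :=
  rfl

lemma singMap_lineSing_of_zero {n : SimplexCategoryᵒᵖ} (σ : (Sing E).obj n)
    (τ : (Δ[1] : SSet.{0}).obj n) (hτ : ∀ i, bit τ i = 0)
    (w : stdSimplex ℝ (Fin (n.unop.len + 1))) : singMap (lineSing σ τ) w =
      affineMap (fun i => singMap σ (stdSimplex.vertex i)) w := by
  have : weight τ w = 0 := by simp [weight, affineMap, hτ]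
  rw [singMap_lineSing, this]
  simp

lemma singMap_lineSing_of_one {n : SimplexCategoryᵒᵖ} (σ : (Sing E).obj n)
    (τ : (Δ[1] : SSet.{0}).obj n) (hτ : ∀ i, bit τ i = 1)
    (w : stdSimplex ℝ (Fin (n.unop.len + 1))) : singMap (lineSing σ τ) w = singMap σ w := by
  have : weight τ w = 1 := by simp [weight, affineMap, hτ]
  rw [singMap_lineSing, this]
  simp

open MonoidalCategory in
/-- The straight line homotopy. -/
def straightHomotopy (hR : ∀ z, Convex ℝ {y | R z y}) :
    SSet.Homotopy (toVertices R ≫ ofVertices hR) (𝟙 (singSmall R : SSet.{0})) where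
  h :=
    { app := fun n => TypeCat.ofHom fun x => ⟨lineSing x.1.1 x.2, by
        obtain ⟨z, hz⟩ := x.1.2
        refine ⟨z, fun w => ?_⟩
        rw [singMap_lineSing]
        have := weight_mem x.2 w
        exact hR z (affineMap_mem (hR z) (fun i => hz _) w) (hz w) (sub_nonneg.2 this.2) this.1
          (sub_add_cancel _ _)⟩
      naturality := fun m n f => by
        ext x
        refine Subtype.ext (sing_ext fun w => ?_)
        change singMap (lineSing ((Sing E).map f x.1.1) ((Δ[1] : SSet.{0}).map f x.2)) w =
          singMap (lineSing x.1.1 x.2) (stdSimplex.map f.unop w)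
        rw [singMap_lineSing, singMap_lineSing, weight_map, singMap_map]
        congr 2
        rw [affineMap_map]
        congr 2
        ext i
        rw [singMap_map, stdSimplex.map_vertex]
        rfl }
  h₀ := by
    ext n σ
    refine Subtype.ext (sing_ext fun w => ?_)
    change singMap (lineSing σ.1 _) w = singMap (affineSing _) w
    rw [singMap_affineSing]
    exact singMap_lineSing_of_zero _ _ (fun i => Nat.cast_zero) w
  h₁ := by
    ext n σ
    refine Subtype.ext (sing_ext fun w => ?_)
    exact singMap_lineSing_of_one _ _ (fun i => Nat.cast_one) w
  rel := by ext _ ⟨⟨_, ⟨⟩⟩, _⟩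

variable (k : Type u) [Field k]

/-- A small simplex and the affine simplex on its vertices lie in a common convex cell, which
contains the segments between them. Only the vertex map is used for comparing families; the affine
section serves as its inverse up to homotopy. -/
theorem hIso_toVertices (hR : ∀ z, Convex ℝ {y | R z y}) : HIso k (toVertices R) :=
  hIso_of_homotopy k (straightHomotopy hR) (ofVertices_toVertices hR)

end Affine

end Singular

/-! ### Subdivision of tuple chains with respect to chosen centres. -/

section Subdivision

variable (k : Type u) [Field k] {V V' : Type}

/-- The map of tuple chains induced by a map. -/
def tmap (g : V → V') (n : ℕ) : ((Fin n → V) →₀ k) →ₗ[k] ((Fin n → V') →₀ k) :=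
  Finsupp.lmapDomain k k fun p => g ∘ p

@[simp]
lemma tmap_single (g : V → V') {n : ℕ} (p : Fin n → V) (a : k) :
    tmap k g n (Finsupp.single p a) = Finsupp.single (g ∘ p) a :=
  Finsupp.mapDomain_single

lemma tmap_tbd (g : V → V') (n : ℕ) (c : (Fin (n + 1) → V) →₀ k) :
    tmap k g n (tbd k n c) = tbd k n (tmap k g (n + 1) c) := by
  induction c using Finsupp.induction_linear with
  | zero => simp
  | add f g hf hg => simp only [map_add, hf, hg]
  | single p a =>
    simp only [tbd_single, tmap_single, map_sum, map_smul]
    rfl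

lemma tmap_tcone (g : V → V') (v : V) (n : ℕ) (c : (Fin n → V) →₀ k) :
    tmap k g (n + 1) (tcone k v n c) = tcone k (g v) n (tmap k g n c) := by
  induction c using Finsupp.induction_linear with
  | zero => simp
  | add f g hf hg => simp only [map_add, hf, hg]
  | single p a => simp [Fin.comp_cons]

variable (b : ∀ {n : ℕ}, (Fin (n + 1) → V) → V) (b' : ∀ {n : ℕ}, (Fin (n + 1) → V') → V')

/-- The subdivision operator on tuple chains given by a choice of centres. -/
def sd (n : ℕ) : ((Fin n → V) →₀ k) →ₗ[k] ((Fin n → V) →₀ k) :=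
  match n with
  | 0 => LinearMap.id
  | n + 1 => Finsupp.linearCombination k fun p =>
      tcone k (b p) n (sd n (tbd k n (Finsupp.single p 1)))

/-- The homotopy between the subdivision operator and the identity. -/
def sdHomotopy (n : ℕ) : ((Fin n → V) →₀ k) →ₗ[k] ((Fin (n + 1) → V) →₀ k) :=
  match n with
  | 0 => 0
  | n + 1 => Finsupp.linearCombination k fun p =>
      tcone k (b p) (n + 1) (sd k b (n + 1) (Finsupp.single p 1) - Finsupp.single p 1 -
        sdHomotopy n (tbd k n (Finsupp.single p 1)))

lemma sd_single (n : ℕ) (p : Fin (n + 1) → V) : sd k b (n + 1) (Finsupp.single p 1) =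
    tcone k (b p) n (sd k b n (tbd k n (Finsupp.single p 1))) := by
  simp [sd]

lemma sdHomotopy_single (n : ℕ) (p : Fin (n + 1) → V) :
    sdHomotopy k b (n + 1) (Finsupp.single p 1) =
      tcone k (b p) (n + 1) (sd k b (n + 1) (Finsupp.single p 1) - Finsupp.single p 1 -
        sdHomotopy k b n (tbd k n (Finsupp.single p 1))) := by
  simp [sdHomotopy]

lemma linearMap_ext_single {α M : Type*} [AddCommGroup M] [Module k M]
    {f g : (α →₀ k) →ₗ[k] M} (h : ∀ x, f (Finsupp.single x 1) = g (Finsupp.single x 1)) (c : α →₀ k) :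
    f c = g c := by
  have : f = g := by
    ext x
    exact h x
  rw [this]

lemma tbd_sd (n : ℕ) (c : (Fin (n + 1) → V) →₀ k) :
    tbd k n (sd k b (n + 1) c) = sd k b n (tbd k n c) := by
  induction n with
  | zero =>
    refine linearMap_ext_single k (f := tbd k 0 ∘ₗ sd k b 1) (g := sd k b 0 ∘ₗ tbd k 0)
      (fun p => ?_) c
    simp only [LinearMap.comp_apply]
    rw [sd_single, tbd_zero_tcone]
  | succ n ih =>
    refine linearMap_ext_single k (f := tbd k (n + 1) ∘ₗ sd k b (n + 2))
      (g := sd k b (n + 1) ∘ₗ tbd k (n + 1)) (fun p => ?_) c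
    simp only [LinearMap.comp_apply]
    rw [sd_single, tbd_tcone, ih, tbd_tbd, map_zero, map_zero, sub_zero]

/-- On a single tuple, the chain being coned in the definition is a cycle by the identity one degree
lower, and coning a cycle yields a chain bounding it. -/
lemma tbd_sdHomotopy (n : ℕ) (c : (Fin (n + 1) → V) →₀ k) :
    tbd k (n + 1) (sdHomotopy k b (n + 1) c) =
      sd k b (n + 1) c - c - sdHomotopy k b n (tbd k n c) := by
  induction n with
  | zero =>
    refine linearMap_ext_single k (f := tbd k 1 ∘ₗ sdHomotopy k b 1)
      (g := sd k b 1 - LinearMap.id - sdHomotopy k b 0 ∘ₗ tbd k 0) (fun p => ?_) c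
    simp only [LinearMap.comp_apply, LinearMap.sub_apply, LinearMap.id_apply]
    rw [sdHomotopy_single, tbd_tcone, map_sub (tbd k 0), map_sub (tbd k 0), tbd_sd]
    simp [sd, sdHomotopy]
  | succ n ih =>
    refine linearMap_ext_single k (f := tbd k (n + 2) ∘ₗ sdHomotopy k b (n + 2))
      (g := sd k b (n + 2) - LinearMap.id - sdHomotopy k b (n + 1) ∘ₗ tbd k (n + 1)) (fun p => ?_) c
    simp only [LinearMap.comp_apply, LinearMap.sub_apply, LinearMap.id_apply]
    rw [sdHomotopy_single, tbd_tcone, map_sub (tbd k (n + 1)), map_sub (tbd k (n + 1)), tbd_sd, ih, tbd_tbd, map_zero, sub_zero,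
      sub_self, map_zero, sub_zero]

variable {b b'}

lemma tmap_sd {g : V → V'} (hg : ∀ {n : ℕ} (p : Fin (n + 1) → V), g (b p) = b' (g ∘ p)) (n : ℕ)
    (c : (Fin n → V) →₀ k) : tmap k g n (sd k b n c) = sd k b' n (tmap k g n c) := by
  induction n with
  | zero => rfl
  | succ n ih =>
    refine linearMap_ext_single k (f := tmap k g (n + 1) ∘ₗ sd k b (n + 1))
      (g := sd k b' (n + 1) ∘ₗ tmap k g (n + 1)) (fun p => ?_) c
    simp only [LinearMap.comp_apply]
    rw [sd_single, tmap_tcone, ih, tmap_tbd, tmap_single, sd_single, hg]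

lemma tmap_sdHomotopy {g : V → V'} (hg : ∀ {n : ℕ} (p : Fin (n + 1) → V), g (b p) = b' (g ∘ p))
    (n : ℕ) (c : (Fin n → V) →₀ k) :
    tmap k g (n + 1) (sdHomotopy k b n c) = sdHomotopy k b' n (tmap k g n c) := by
  induction n with
  | zero => simp [sdHomotopy]
  | succ n ih =>
    refine linearMap_ext_single k (f := tmap k g (n + 2) ∘ₗ sdHomotopy k b (n + 1))
      (g := sdHomotopy k b' (n + 1) ∘ₗ tmap k g (n + 1)) (fun p => ?_) c
    simp only [LinearMap.comp_apply]
    rw [sdHomotopy_single, tmap_tcone, map_sub (tmap k g _), map_sub (tmap k g _), ih, tmap_tbd, tmap_sd k hg, tmap_single,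
      sdHomotopy_single, hg]

end Subdivision

/-! ### Barycentric subdivision shrinks the mesh. -/

section Mesh

variable (k : Type u) [Field k]

/-- The standard simplex with `n` vertices. -/
abbrev Simp (n : ℕ) : Type := stdSimplex ℝ (Fin n)

variable {n : ℕ}

/-- The affine map between standard simplices with prescribed images of the vertices. -/
def affineSimp {m : ℕ} (q : Fin m → Simp n) : C(Simp m, Simp n) where
  toFun w := ⟨affineMap (fun i => (q i).1) w, affineMap_mem (convex_stdSimplex ℝ _) (fun i => (q i).2) w⟩
  continuous_toFun := (affineMap _).continuous.subtype_mk _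

lemma affineSimp_val {m : ℕ} (q : Fin m → Simp n) (w : Simp m) :
    (affineSimp q w).1 = ∑ i, w i • (q i).1 := rfl

lemma affineSimp_vertex {m : ℕ} (q : Fin m → Simp n) (i : Fin m) :
    affineSimp q (stdSimplex.vertex i) = q i :=
  Subtype.ext (affineMap_vertex _ i)

lemma affineSimp_map {m l : ℕ} (f : Fin l → Fin m) (q : Fin m → Simp n) (w : Simp l) :
    affineSimp q (stdSimplex.map f w) = affineSimp (q ∘ f) w :=
  Subtype.ext (affineMap_map f _ w)

lemma affineSimp_vertices (w : Simp n) : affineSimp (stdSimplex.vertex (S := ℝ)) w = w := by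
  refine Subtype.ext ?_
  rw [affineSimp_val]
  ext j
  simp [Finset.sum_apply, Pi.single_apply]
  rfl

lemma affineSimp_affineSimp {m l : ℕ} (q : Fin m → Simp n) (r : Fin l → Simp m) (w : Simp l) :
    affineSimp q (affineSimp r w) = affineSimp (affineSimp q ∘ r) w := by
  refine Subtype.ext ?_
  rw [affineSimp_val, affineSimp_val]
  have (i : Fin m) : affineSimp r w i = ∑ j, w j * r j i := by
    change (affineSimp r w).1 i = _
    rw [affineSimp_val, Finset.sum_apply]
    rfl
  simp only [this, Finset.sum_smul, Function.comp_apply, affineSimp_val, Finset.smul_sum, mul_smul]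
  exact Finset.sum_comm

/-- The uniform barycentric coordinates. -/
def uniform (n : ℕ) : Simp (n + 1) :=
  ⟨fun _ => ((n : ℝ) + 1)⁻¹, fun _ => by positivity, by
    simp [mul_inv_cancel₀ (Nat.cast_add_one_ne_zero n : (n : ℝ) + 1 ≠ 0)]⟩

/-- The barycenter of a tuple of points of a standard simplex. -/
def bary {m : ℕ} (q : Fin (m + 1) → Simp n) : Simp n := affineSimp q (uniform m)

lemma affineSimp_bary {m l : ℕ} (q : Fin m → Simp n) (p : Fin (l + 1) → Simp m) :
    affineSimp q (bary p) = bary (affineSimp q ∘ p) :=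
  affineSimp_affineSimp q p _

/-- The difference $p_i-\mathrm{bary}(p)$ is the mean of the `m + 1` differences $p_i-p_j$, one of
which vanishes. -/
lemma dist_bary_le {m : ℕ} {D : ℝ} {p : Fin (m + 1) → Simp n}
    (hp : ∀ i j, dist (p i) (p j) ≤ D) (i : Fin (m + 1)) :
    dist (p i) (bary p) ≤ m / (m + 1) * D := by
  have hm : (0 : ℝ) < m + 1 := by positivity
  have h : (p i).1 - (bary p).1 = ∑ j ∈ Finset.univ.erase i, ((m : ℝ) + 1)⁻¹ • ((p i).1 - (p j).1) := by
    rw [← add_zero (∑ j ∈ _, _)]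
    have h0 : ((m : ℝ) + 1)⁻¹ • ((p i).1 - (p i).1) = 0 := by simp
    rw [← h0, Finset.sum_erase_add _ _ (Finset.mem_univ i), ← Finset.smul_sum,
      Finset.sum_sub_distrib, Finset.sum_const, smul_sub, Finset.card_univ, Fintype.card_fin,
      ← Nat.cast_smul_eq_nsmul ℝ, smul_smul, Nat.cast_add_one, inv_mul_cancel₀ hm.ne', one_smul,
      Finset.smul_sum]
    rfl
  rw [Subtype.dist_eq, dist_eq_norm, h]
  refine (norm_sum_le_of_le (Finset.univ.erase i) (n := fun _ => ((m : ℝ) + 1)⁻¹ * D)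
    fun j _ => ?_).trans ?_
  · rw [norm_smul, Real.norm_of_nonneg (by positivity)]
    refine mul_le_mul_of_nonneg_left ?_ (by positivity)
    rw [← dist_eq_norm]
    exact hp i j
  · rw [Finset.sum_const, Finset.card_erase_of_mem (Finset.mem_univ i), Finset.card_univ,
      Fintype.card_fin, Nat.add_sub_cancel, nsmul_eq_mul, div_eq_mul_inv, mul_assoc]

lemma dist_affineSimp_le {m : ℕ} {D : ℝ} {p : Fin m → Simp n} {v : Simp n}
    (h : ∀ i, dist (p i) v ≤ D) (w : Simp m) : dist (affineSimp p w) v ≤ D :=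
  affineMap_mem (A := Metric.closedBall v.1 D) (convex_closedBall _ _) h w

/-- The tuples with mesh at most `r` all of whose entries have distance at most `D'` to every
point having distance at most `D'` to the entries of `p`. -/
def meshSet {m : ℕ} (p : Fin m → Simp n) (r : ℝ) : Set (Fin m → Simp n) :=
  {q | (∀ i j, dist (q i) (q j) ≤ r) ∧
    ∀ (v : Simp n) (s : ℝ), (∀ i, dist (p i) v ≤ s) → ∀ i, dist (q i) v ≤ s}

/-- The second condition in `meshSet` carries the induction: a ball around the barycentre that
contains the vertices of a face also contains the vertices of its subdivision. -/
lemma sd_mem_mesh {m : ℕ} {D : ℝ} {p : Fin m → Simp n} (hD : 0 ≤ D)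
    (hp : ∀ i j, dist (p i) (p j) ≤ D) :
    sd k bary m (Finsupp.single p 1) ∈ Finsupp.supported k k (meshSet p (m / (m + 1) * D)) := by
  induction m with
  | zero => exact Finsupp.single_mem_supported k _ ⟨fun i => i.elim0, fun _ _ _ i => i.elim0⟩
  | succ m ih =>
    rw [sd_single, tbd_single, map_sum, map_sum]
    refine Submodule.sum_mem _ fun i _ => ?_
    rw [map_smul, map_smul]
    refine Submodule.smul_mem _ _ ?_
    refine linearMap_mem_of_supported k _ (fun q hq => ?_)
      (ih (p := p ∘ i.succAbove) fun i j => hp _ _)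
    rw [tcone_single]
    refine Finsupp.single_mem_supported k _ ?_
    -- The factor is indexed by the number of vertices rather than the dimension. This is weaker
    -- than the usual estimate, but any factor below one suffices.
    have h1 : (m : ℝ) / (m + 1) ≤ ((m + 1 : ℕ) : ℝ) / ((m + 1 : ℕ) + 1) := by
      rw [div_le_div_iff₀ (by positivity) (by positivity)]
      push_cast
      nlinarith
    have h2 : (m : ℝ) / (m + 1) * D ≤ ((m + 1 : ℕ) : ℝ) / ((m + 1 : ℕ) + 1) * D :=
      mul_le_mul_of_nonneg_right h1 hD
    have h3 (j : Fin m) : dist (q j) (bary p) ≤ ((m + 1 : ℕ) : ℝ) / ((m + 1 : ℕ) + 1) * D :=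
      (hq.2 _ _ (fun j => dist_bary_le hp _) j).trans h2
    constructor
    · intro a c
      refine Fin.cases ?_ (fun a => ?_) a <;> refine Fin.cases ?_ (fun c => ?_) c
      · simp only [Fin.cons_zero, dist_self]
        positivity
      · rw [Fin.cons_zero, Fin.cons_succ, dist_comm]
        exact h3 c
      · exact h3 a
      · exact (hq.1 a c).trans h2
    · intro v s hs a
      refine Fin.cases ?_ (fun a => ?_) a
      · exact dist_affineSimp_le hs _
      · exact hq.2 v s (fun j => hs _) a

lemma iterate_sd_mem_mesh {m : ℕ} (p : Fin m → Simp n) (hp : ∀ i j, dist (p i) (p j) ≤ 1) (l : ℕ) :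
    (sd k bary m ^ l) (Finsupp.single p 1) ∈
      Finsupp.supported k k {q | ∀ i j, dist (q i) (q j) ≤ ((m : ℝ) / (m + 1)) ^ l} := by
  induction l with
  | zero => exact Finsupp.single_mem_supported k _ (by simpa using hp)
  | succ l ih =>
    rw [pow_succ' (sd k bary m), Module.End.mul_apply]
    refine linearMap_mem_of_supported k _ (fun q hq => ?_) ih
    have h := sd_mem_mesh k (D := ((m : ℝ) / (m + 1)) ^ l) (by positivity) hq
    rw [← pow_succ'] at h
    have h2 : meshSet q (((m : ℝ) / (m + 1)) ^ (l + 1)) ⊆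
      {q | ∀ i j, dist (q i) (q j) ≤ ((m : ℝ) / (m + 1)) ^ (l + 1)} := fun _ hq => hq.1
    exact Finsupp.supported_mono h2 h

end Mesh

/-! ### Homology isomorphisms between subcomplexes. -/

section Subcomplex

variable (k : Type u) [Field k] {S : SSet.{0}} {A B : S.Subcomplex}

/-- The chains of a simplicial set supported on a subcomplex. -/
abbrev supp (A : S.Subcomplex) (n : ℕ) : Submodule k (S _⦋n⦌ →₀ k) :=
  Finsupp.supported k k (A.obj (.op ⦋n⦌))

/-- The simplex of the ambient simplicial set underlying a simplex of a subcomplex. -/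
def under {n : ℕ} (x : (B : SSet.{0}) _⦋n⦌) : S _⦋n⦌ := x.1

lemma under_injective (n : ℕ) : Function.Injective (under (B := B) (n := n)) :=
  Subtype.val_injective

lemma range_under (n : ℕ) : Set.range (under (B := B) (n := n)) = B.obj (.op ⦋n⦌) :=
  Subtype.range_val

/-- The map induced on chains by the inclusion of a subcomplex. -/
def underChains (B : S.Subcomplex) (n : ℕ) : ((B : SSet.{0}) _⦋n⦌ →₀ k) →ₗ[k] (S _⦋n⦌ →₀ k) :=
  Finsupp.lmapDomain k k under

lemma underChains_single (n : ℕ) (x : (B : SSet.{0}) _⦋n⦌) (a : k) :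
    underChains k B n (Finsupp.single x a) = Finsupp.single (under x) a :=
  Finsupp.mapDomain_single

lemma range_underChains (n : ℕ) : LinearMap.range (underChains k B n) = supp k B n := by
  rw [LinearMap.range_eq_map, ← Finsupp.supported_univ, underChains, Finsupp.lmapDomain_supported,
    Set.image_univ, range_under]

lemma bd_underChains (n : ℕ) (a : (B : SSet.{0}) _⦋n + 1⦌ →₀ k) :
    bd k S n (underChains k B (n + 1) a) = underChains k B n (bd k _ n a) := by
  induction a using Finsupp.induction_linear with
  | zero => simp
  | add f g hf hg => simp only [map_add, hf, hg]
  | single x a =>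
    simp only [bd_single, map_sum, map_smul, underChains_single]
    rfl

lemma underChains_mem_iff (n : ℕ) (h : A ≤ B) (a : (B : SSet.{0}) _⦋n⦌ →₀ k) :
    a ∈ imChains k (SSet.Subcomplex.homOfLE h) n ↔ underChains k B n a ∈ supp k A n := by
  classical
  have h1 : Set.range ((SSet.Subcomplex.homOfLE h).app (Opposite.op ⦋n⦌)) =
      under ⁻¹' (A.obj (.op ⦋n⦌)) := by
    ext x
    constructor
    · rintro ⟨y, rfl⟩
      exact y.2
    · intro hx
      exact ⟨⟨under x, hx⟩, rfl⟩
  rw [imChains, h1, Finsupp.mem_supported k (underChains k B n a), underChains,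
    Finsupp.lmapDomain_apply, Finsupp.mapDomain_support_of_injective (under_injective n),
    Finset.coe_image, Set.image_subset_iff]
  rfl

theorem hIso_homOfLE (h : A ≤ B)
    (h₀ : ∀ c ∈ supp k B 0, ∃ b ∈ supp k B 1, c - bd k S 0 b ∈ supp k A 0)
    (h₁ : ∀ n, ∀ c ∈ supp k B (n + 1), bd k S n c ∈ supp k A n →
      ∃ b ∈ supp k B (n + 2), c - bd k S (n + 1) b ∈ supp k A (n + 1)) :
    HIso k (SSet.Subcomplex.homOfLE h) := by
  have hr (n : ℕ) (a : (B : SSet.{0}) _⦋n⦌ →₀ k) : underChains k B n a ∈ supp k B n := by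
    rw [← range_underChains]
    exact ⟨a, rfl⟩
  apply quasiIso_of_chains
  · intro a
    obtain ⟨b, hb, hb'⟩ := h₀ _ (hr 0 a)
    rw [← range_underChains] at hb
    obtain ⟨b, rfl⟩ := hb
    refine ⟨b, ?_⟩
    rwa [underChains_mem_iff, map_sub, ← bd_underChains]
  · intro n a ha
    rw [underChains_mem_iff, ← bd_underChains] at ha
    obtain ⟨b, hb, hb'⟩ := h₁ n _ (hr _ a) ha
    rw [← range_underChains] at hb
    obtain ⟨b, rfl⟩ := hb
    refine ⟨b, ?_⟩
    rwa [underChains_mem_iff, map_sub, ← bd_underChains]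

end Subcomplex

/-! ### Every singular chain can be subdivided into small simplices. -/

section SmallSimplices

variable (k : Type u) [Field k] {E : Type} [TopologicalSpace E]

/-- The precomposition of a singular simplex with an affine map of standard simplices. -/
def pull {n m : ℕ} (σ : (Sing E) _⦋n⦌) (q : Fin (m + 1) → Simp (n + 1)) : (Sing E) _⦋m⦌ :=
  ((TopCat.of E).toSSetObjEquiv (.op ⦋m⦌)).symm ((singMap σ).comp (affineSimp q))

lemma pull_vertex {n : ℕ} (σ : (Sing E) _⦋n⦌) : pull σ (stdSimplex.vertex (S := ℝ)) = σ :=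
  sing_ext fun w => congrArg (singMap σ) (affineSimp_vertices w)

lemma pull_pull {n m l : ℕ} (σ : (Sing E) _⦋n⦌) (q : Fin (m + 1) → Simp (n + 1))
    (r : Fin (l + 1) → Simp (m + 1)) : pull (pull σ q) r = pull σ (affineSimp q ∘ r) :=
  sing_ext fun w => congrArg (singMap σ) (affineSimp_affineSimp q r w)

lemma δ_pull {n m : ℕ} (σ : (Sing E) _⦋n⦌) (q : Fin (m + 2) → Simp (n + 1)) (i : Fin (m + 2)) :
    (Sing E).δ i (pull σ q) = pull σ (q ∘ i.succAbove) :=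
  sing_ext fun w => congrArg (singMap σ) (affineSimp_map i.succAbove q w)

/-- The singular chain defined by a chain of tuples in the domain of a singular simplex. -/
def pullChains {n : ℕ} (σ : (Sing E) _⦋n⦌) (m : ℕ) :
    ((Fin (m + 1) → Simp (n + 1)) →₀ k) →ₗ[k] ((Sing E) _⦋m⦌ →₀ k) :=
  Finsupp.lmapDomain k k (pull σ)

lemma pullChains_single {n m : ℕ} (σ : (Sing E) _⦋n⦌) (q : Fin (m + 1) → Simp (n + 1)) (a : k) :
    pullChains k σ m (Finsupp.single q a) = Finsupp.single (pull σ q) a :=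
  Finsupp.mapDomain_single

lemma bd_pullChains {n m : ℕ} (σ : (Sing E) _⦋n⦌) (c : (Fin (m + 2) → Simp (n + 1)) →₀ k) :
    bd k (Sing E) m (pullChains k σ (m + 1) c) = pullChains k σ m (tbd k (m + 1) c) := by
  induction c using Finsupp.induction_linear with
  | zero => simp
  | add f g hf hg => simp only [map_add, hf, hg]
  | single x a => simp only [tbd_single, bd_single, map_sum, map_smul, pullChains_single, δ_pull]

lemma pullChains_pull {n m l : ℕ} (σ : (Sing E) _⦋n⦌) (q : Fin (m + 1) → Simp (n + 1))
    (c : (Fin (l + 1) → Simp (m + 1)) →₀ k) :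
    pullChains k (pull σ q) l c = pullChains k σ l (tmap k (affineSimp q) (l + 1) c) := by
  induction c using Finsupp.induction_linear with
  | zero => simp
  | add f g hf hg => simp only [map_add, hf, hg]
  | single x a => rw [tmap_single, pullChains_single, pullChains_single, pull_pull]

lemma pullChains_vertex {n : ℕ} (σ : (Sing E) _⦋n⦌) (a : k) :
    pullChains k σ n (Finsupp.single (stdSimplex.vertex (S := ℝ)) a) = Finsupp.single σ a := by
  rw [pullChains_single, pull_vertex]

/-- A natural family of operators on tuple chains in standard simplices. -/
structure NatOp (a : ℕ) where
  /-- the operators -/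
  op : ∀ n m : ℕ, ((Fin (m + 1) → Simp (n + 1)) →₀ k) →ₗ[k] ((Fin (m + a + 1) → Simp (n + 1)) →₀ k)
  tmap_op : ∀ {n m l : ℕ} (q : Fin (m + 1) → Simp (n + 1)) (c : (Fin (l + 1) → Simp (m + 1)) →₀ k),
    tmap k (affineSimp q) _ (op m l c) = op n l (tmap k (affineSimp q) _ c)

variable {k}

/-- The operator on singular chains induced by a natural family of operators on tuple chains. -/
def NatOp.sing {a : ℕ} (T : NatOp k a) (E : Type) [TopologicalSpace E] (n : ℕ) :
    ((Sing E) _⦋n⦌ →₀ k) →ₗ[k] ((Sing E) _⦋n + a⦌ →₀ k) :=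
  Finsupp.linearCombination k fun σ =>
    pullChains k σ (n + a) (T.op n n (Finsupp.single (stdSimplex.vertex (S := ℝ)) 1))

lemma NatOp.sing_single {a : ℕ} (T : NatOp k a) {n : ℕ} (σ : (Sing E) _⦋n⦌) :
    T.sing E n (Finsupp.single σ 1) =
      pullChains k σ (n + a) (T.op n n (Finsupp.single (stdSimplex.vertex (S := ℝ)) 1)) := by
  simp [sing]

/-- Naturality in affine maps lets the operator be computed inside the domain of `σ`. Identities
between tuple operators thereby carry over to singular chains, since each simplex is the pullback of
the tuple of vertices. -/
lemma NatOp.sing_pullChains {a : ℕ} (T : NatOp k a) {n m : ℕ} (σ : (Sing E) _⦋n⦌)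
    (c : (Fin (m + 1) → Simp (n + 1)) →₀ k) :
    T.sing E m (pullChains k σ m c) = pullChains k σ (m + a) (T.op n m c) := by
  refine linearMap_ext_single k (f := T.sing E m ∘ₗ pullChains k σ m)
    (g := pullChains k σ (m + a) ∘ₗ T.op n m) (fun q => ?_) c
  simp only [LinearMap.comp_apply]
  rw [pullChains_single, T.sing_single, pullChains_pull, T.tmap_op, tmap_single]
  congr 3
  exact funext fun i => affineSimp_vertex q i

/-- The subcomplex is closed under precomposition with affine maps. -/
def IsPullStable (A : (Sing E).Subcomplex) : Prop :=
  ∀ ⦃n m : ℕ⦄ (σ : (Sing E) _⦋n⦌) (q : Fin (m + 1) → Simp (n + 1)),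
    σ ∈ A.obj (.op ⦋n⦌) → pull σ q ∈ A.obj (.op ⦋m⦌)

lemma isPullStable_singOf (A : Set E) : IsPullStable (singOf A) :=
  fun _ _ _ _ hσ _ => hσ _

lemma isPullStable_singSmall {Z : Type} (R : Z → E → Prop) : IsPullStable (singSmall R) :=
  fun _ _ _ _ ⟨z, hz⟩ => ⟨z, fun _ => hz _⟩

lemma pullChains_mem {A : (Sing E).Subcomplex} (hA : IsPullStable A) {n m : ℕ} {σ : (Sing E) _⦋n⦌}
    (hσ : σ ∈ A.obj (.op ⦋n⦌)) (c : (Fin (m + 1) → Simp (n + 1)) →₀ k) :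
    pullChains k σ m c ∈ supp k A m := by
  have hc : c ∈ Finsupp.supported k k Set.univ := by
    rw [Finsupp.supported_univ]
    trivial
  refine linearMap_mem_of_supported k _ (fun q _ => ?_) hc
  rw [pullChains_single]
  exact Finsupp.single_mem_supported k _ (hA _ _ hσ)

lemma NatOp.sing_mem {a : ℕ} (T : NatOp k a) {A : (Sing E).Subcomplex} (hA : IsPullStable A) {n : ℕ}
    {c : (Sing E) _⦋n⦌ →₀ k} (hc : c ∈ supp k A n) : T.sing E n c ∈ supp k A (n + a) := by
  refine linearMap_mem_of_supported k _ (fun σ hσ => ?_) hc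
  rw [T.sing_single]
  exact pullChains_mem hA hσ _

variable (k)

/-- Barycentric subdivision of tuple chains. -/
def sdOp : NatOp k 0 where
  op _ m := sd k bary (m + 1)
  tmap_op q c := tmap_sd k (affineSimp_bary q) _ c

/-- The homotopy for barycentric subdivision of tuple chains. -/
def sdHomotopyOp : NatOp k 1 where
  op _ m := sdHomotopy k bary (m + 1)
  tmap_op q c := tmap_sdHomotopy k (affineSimp_bary q) _ c

lemma bd_sdOp (n : ℕ) (c : (Sing E) _⦋n + 1⦌ →₀ k) :
    bd k (Sing E) n ((sdOp k).sing E (n + 1) c) = (sdOp k).sing E n (bd k (Sing E) n c) := by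
  refine linearMap_ext_single k (f := bd k (Sing E) n ∘ₗ (sdOp k).sing E (n + 1))
    (g := (sdOp k).sing E n ∘ₗ bd k (Sing E) n) (fun σ => ?_) c
  simp only [LinearMap.comp_apply]
  rw [← pullChains_vertex, NatOp.sing_pullChains]
  erw [bd_pullChains, bd_pullChains, NatOp.sing_pullChains]
  congr 1
  exact tbd_sd k _ _ _

lemma bd_sdHomotopyOp_zero (c : (Sing E) _⦋0⦌ →₀ k) :
    bd k (Sing E) 0 ((sdHomotopyOp k).sing E 0 c) = (sdOp k).sing E 0 c - c := by
  refine linearMap_ext_single k (f := bd k (Sing E) 0 ∘ₗ (sdHomotopyOp k).sing E 0)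
    (g := (sdOp k).sing E 0 - LinearMap.id) (fun σ => ?_) c
  simp only [LinearMap.comp_apply, LinearMap.sub_apply, LinearMap.id_apply]
  rw [← pullChains_vertex, NatOp.sing_pullChains, NatOp.sing_pullChains]
  erw [bd_pullChains, ← map_sub]
  congr 1
  refine (tbd_sdHomotopy k _ _ _).trans ?_
  simp only [sdHomotopy, LinearMap.zero_apply, sub_zero]
  rfl

lemma bd_sdHomotopyOp_succ (n : ℕ) (c : (Sing E) _⦋n + 1⦌ →₀ k) :
    bd k (Sing E) (n + 1) ((sdHomotopyOp k).sing E (n + 1) c) =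
      (sdOp k).sing E (n + 1) c - c - (sdHomotopyOp k).sing E n (bd k (Sing E) n c) := by
  refine linearMap_ext_single k (f := bd k (Sing E) (n + 1) ∘ₗ (sdHomotopyOp k).sing E (n + 1))
    (g := (sdOp k).sing E (n + 1) - LinearMap.id - (sdHomotopyOp k).sing E n ∘ₗ bd k (Sing E) n)
    (fun σ => ?_) c
  simp only [LinearMap.comp_apply, LinearMap.sub_apply, LinearMap.id_apply]
  rw [← pullChains_vertex, NatOp.sing_pullChains, NatOp.sing_pullChains]
  erw [bd_pullChains, bd_pullChains, NatOp.sing_pullChains, ← map_sub, ← map_sub]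
  congr 1
  exact tbd_sdHomotopy k _ _ _

/-- Barycentric subdivision of singular chains. -/
def subdivision (E : Type) [TopologicalSpace E] (n : ℕ) :
    ((Sing E) _⦋n⦌ →₀ k) →ₗ[k] ((Sing E) _⦋n⦌ →₀ k) :=
  (sdOp k).sing E n

lemma subdivision_pow_mem {A : (Sing E).Subcomplex} (hA : IsPullStable A) {n : ℕ}
    {c : (Sing E) _⦋n⦌ →₀ k} (hc : c ∈ supp k A n) (j : ℕ) :
    (subdivision k E n ^ j) c ∈ supp k A n := by
  induction j with
  | zero => exact hc
  | succ j ih =>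
    rw [pow_succ' (subdivision k E n), Module.End.mul_apply]
    exact (sdOp k).sing_mem hA ih

lemma bd_subdivision_pow (n : ℕ) (c : (Sing E) _⦋n + 1⦌ →₀ k) (j : ℕ) :
    bd k (Sing E) n ((subdivision k E (n + 1) ^ j) c) =
      (subdivision k E n ^ j) (bd k (Sing E) n c) := by
  induction j with
  | zero => rfl
  | succ j ih =>
    rw [pow_succ' (subdivision k E n), pow_succ' (subdivision k E (n + 1)), Module.End.mul_apply,
      Module.End.mul_apply, ← ih]
    exact bd_sdOp k n _

lemma subdivision_pow_pullChains {n m : ℕ} (σ : (Sing E) _⦋n⦌)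
    (c : (Fin (m + 1) → Simp (n + 1)) →₀ k) (j : ℕ) :
    (subdivision k E m ^ j) (pullChains k σ m c) = pullChains k σ m ((sd k bary (m + 1) ^ j) c) := by
  induction j with
  | zero => rfl
  | succ j ih =>
    rw [pow_succ' (subdivision k E m), pow_succ' (sd k bary (m + 1)), Module.End.mul_apply,
      Module.End.mul_apply, ih]
    exact (sdOp k).sing_pullChains σ _

/-- Summing the homotopies between successive subdivisions shows that `c` and its `j`-fold
subdivision differ by a boundary, modulo the error terms in `A`. -/
lemma exists_sub_bd_sub_subdivision_pow_mem {A B : (Sing E).Subcomplex} (hB : IsPullStable B)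
    {n : ℕ} {c : (Sing E) _⦋n⦌ →₀ k} (hc : c ∈ supp k B n)
    (h : ∀ j, ∃ e ∈ supp k A n,
      bd k (Sing E) n ((sdHomotopyOp k).sing E n ((subdivision k E n ^ j) c)) =
        (subdivision k E n ^ (j + 1)) c - (subdivision k E n ^ j) c - e) (j : ℕ) :
    ∃ b ∈ supp k B (n + 1),
      c - bd k (Sing E) n b - (subdivision k E n ^ j) c ∈ supp k A n := by
  induction j with
  | zero => exact ⟨0, zero_mem _, by simp⟩
  | succ j ih =>
    obtain ⟨b, hb, hb'⟩ := ih
    obtain ⟨e, he, he'⟩ := h j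
    refine ⟨b - (sdHomotopyOp k).sing E n ((subdivision k E n ^ j) c),
      sub_mem hb ((sdHomotopyOp k).sing_mem hB (subdivision_pow_mem k hB hc j)), ?_⟩
    rw [map_sub, he']
    convert sub_mem hb' he using 1
    abel

lemma dist_stdSimplex_le_one {n : ℕ} (p q : Simp n) : dist p q ≤ 1 := by
  rw [Subtype.dist_eq, dist_pi_le_iff zero_le_one]
  intro i
  have h1 := p.2.1 i
  have h2 := q.2.1 i
  have h3 := (mem_Icc_of_mem_stdSimplex p.2 i).2
  have h4 := (mem_Icc_of_mem_stdSimplex q.2 i).2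
  rw [Real.dist_eq, abs_le]
  constructor <;> linarith

variable {Z : Type} {R : Z → E → Prop}

/-- Subdivision takes place in the compact domain of `σ`, until the mesh is below a Lebesgue number
of the pulled-back cover. -/
lemma exists_subdivision_pow_mem (hR : ∀ z, IsOpen {y | R z y}) {n : ℕ} {σ : (Sing E) _⦋n⦌}
    (hσ : σ ∈ (singOf {y | ∃ z, R z y}).obj (.op ⦋n⦌)) :
    ∃ J, (subdivision k E n ^ J) (Finsupp.single σ 1) ∈ supp k (singSmall R) n := by
  obtain ⟨δ, hδ, h⟩ := lebesgue_number_lemma_of_metric (s := (Set.univ : Set (Simp (n + 1))))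
    (c := fun z => singMap σ ⁻¹' {y | R z y}) isCompact_univ
    (fun z => (hR z).preimage (singMap σ).continuous)
    (fun w _ => by
      obtain ⟨z, hz⟩ := hσ w
      exact Set.mem_iUnion.2 ⟨z, hz⟩)
  obtain ⟨J, hJ⟩ := exists_pow_lt_of_lt_one hδ
    (show (((n + 1 : ℕ) : ℝ) / ((n + 1 : ℕ) + 1)) < 1 by
      rw [div_lt_one (by positivity)]
      linarith)
  refine ⟨J, ?_⟩
  rw [← pullChains_vertex, subdivision_pow_pullChains]
  refine linearMap_mem_of_supported k _ (fun q hq => ?_)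
    (iterate_sd_mem_mesh k _ (fun _ _ => dist_stdSimplex_le_one _ _) J)
  rw [pullChains_single]
  refine Finsupp.single_mem_supported k _ ?_
  obtain ⟨z, hz⟩ := h (q 0) trivial
  exact ⟨z, fun w => hz ((dist_affineSimp_le (fun i => hq i 0) w).trans_lt hJ)⟩

lemma exists_subdivision_pow_mem_of_chain (hR : ∀ z, IsOpen {y | R z y}) {n : ℕ}
    {c : (Sing E) _⦋n⦌ →₀ k} (hc : c ∈ supp k (singOf {y | ∃ z, R z y}) n) :
    ∃ J, (subdivision k E n ^ J) c ∈ supp k (singSmall R) n := by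
  classical
  choose! J hJ using fun (σ : (Sing E) _⦋n⦌) hσ => exists_subdivision_pow_mem k hR (σ := σ) hσ
  -- The largest exponent works for all simplices, because further subdivision keeps a chain small.
  refine ⟨c.support.sup J, ?_⟩
  refine linearMap_mem_of_supported k (s := c.support) _ (fun σ hσ => ?_) (fun _ h => h)
  obtain ⟨j, hj⟩ := Nat.exists_eq_add_of_le' (Finset.le_sup (f := J) hσ)
  rw [hj, pow_add, Module.End.mul_apply]
  exact subdivision_pow_mem k (isPullStable_singSmall R) (hJ σ (hc hσ)) j

theorem hIso_homOfLE_singSmall (hR : ∀ z, IsOpen {y | R z y}) :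
    HIso k (SSet.Subcomplex.homOfLE (singSmall_le R)) := by
  have key (n : ℕ) (c : (Sing E) _⦋n⦌ →₀ k) (hc : c ∈ supp k (singOf {y | ∃ z, R z y}) n)
      (h : ∀ j, ∃ e ∈ supp k (singSmall R) n,
      bd k (Sing E) n ((sdHomotopyOp k).sing E n ((subdivision k E n ^ j) c)) =
        (subdivision k E n ^ (j + 1)) c - (subdivision k E n ^ j) c - e) :
      ∃ b ∈ supp k (singOf {y | ∃ z, R z y}) (n + 1),
        c - bd k (Sing E) n b ∈ supp k (singSmall R) n := by
    obtain ⟨J, hJ⟩ := exists_subdivision_pow_mem_of_chain k hR hc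
    obtain ⟨b, hb, hb'⟩ := exists_sub_bd_sub_subdivision_pow_mem k (isPullStable_singOf _) hc h J
    exact ⟨b, hb, by simpa using add_mem hb' hJ⟩
  apply hIso_homOfLE
  · intro c hc
    refine key 0 c hc fun j => ⟨0, zero_mem _, ?_⟩
    rw [sub_zero, pow_succ' (subdivision k E 0), Module.End.mul_apply]
    exact bd_sdHomotopyOp_zero k _
  · intro n c hc hc'
    -- The error term is the homotopy applied to a subdivision of the boundary of `c`, which is
    -- small because `c` is a relative cycle.
    refine key (n + 1) c hc fun j => ⟨_, (sdHomotopyOp k).sing_mem (isPullStable_singSmall R)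
      (subdivision_pow_mem k (isPullStable_singSmall R) hc' j), ?_⟩
    rw [← bd_subdivision_pow, pow_succ' (subdivision k E (n + 1)), Module.End.mul_apply]
    exact bd_sdHomotopyOp_succ k n _

end SmallSimplices

/-! ### Singular simplices of subspaces as subcomplexes of the ambient ones. -/

section Subspaces

variable {T : Type} [Preorder T] {E : Type} [TopologicalSpace E] {S : SSet.{0}}

/-- The functor given by a monotone family of subcomplexes. -/
abbrev subFunctor {A : T → S.Subcomplex} (hA : Monotone A) : T ⥤ SSet.{0} :=
  hA.functor ⋙ SSet.Subcomplex.toSSetFunctor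

/-- The inclusion of monotone families of subcomplexes. -/
def subIncl {A B : T → S.Subcomplex} (hA : Monotone A) (hB : Monotone B) (h : ∀ t, A t ≤ B t) :
    subFunctor hA ⟶ subFunctor hB where
  app t := SSet.Subcomplex.homOfLE (h t)

lemma mono_subIncl_app {A B : T → S.Subcomplex} (hA : Monotone A) (hB : Monotone B)
    (h : ∀ t, A t ≤ B t) (t : T) : Mono ((subIncl hA hB h).app t) :=
  SSet.Subcomplex.mono_homOfLE (h t)

/-- The singular simplicial sets of a monotone family of subspaces. -/
def subspaceFunctor {A : T → Set E} (hA : Monotone A) : T ⥤ SSet.{0} where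
  obj t := Sing (A t)
  map i := TopCat.toSSet.map (TopCat.ofHom ⟨Set.inclusion (hA (leOfHom i)), continuous_inclusion _⟩)

/-- The inclusion of the singular simplicial sets of monotone families of subspaces. -/
def subspaceIncl {A B : T → Set E} (hA : Monotone A) (hB : Monotone B) (h : ∀ t, A t ⊆ B t) :
    subspaceFunctor hA ⟶ subspaceFunctor hB where
  app t := TopCat.toSSet.map (TopCat.ofHom ⟨Set.inclusion (h t), continuous_inclusion _⟩)

/-- The singular simplices of a subspace as singular simplices of the ambient space. -/
def ofSubspace (A : Set E) : Sing A ⟶ (singOf A : SSet.{0}) where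
  app n := TypeCat.ofHom fun σ => ⟨((TopCat.of E).toSSetObjEquiv n).symm
    ((ContinuousMap.mk Subtype.val continuous_subtype_val).comp (singMap σ)),
    fun w => (singMap σ w).2⟩

instance isIso_ofSubspace (A : Set E) : IsIso (ofSubspace A) := by
  rw [NatTrans.isIso_iff_isIso_app]
  intro n
  rw [isIso_iff_bijective]
  constructor
  · intro σ τ h
    exact sing_ext fun w => Subtype.ext
      (congrArg (fun x : (singOf A : SSet.{0}).obj n => singMap x.1 w) h)
  · intro σ
    exact ⟨((TopCat.of A).toSSetObjEquiv n).symm ⟨fun w => ⟨singMap σ.1 w, σ.2 w⟩,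
      (singMap σ.1).continuous.subtype_mk _⟩, Subtype.ext (sing_ext fun w => rfl)⟩

lemma monotone_singOf {A : T → Set E} (hA : Monotone A) : Monotone fun t => singOf (A t) :=
  fun _ _ hab => singOf_mono (hA hab)

lemma relH_iso_subspace (k : Type u) [Field k] {A B : T → Set E} (hA : Monotone A)
    (hB : Monotone B) (h : ∀ t, A t ⊆ B t) (n : ℕ) :
    Nonempty (arrowFunctor (subspaceIncl hA hB h) ⋙ relH k n ≅
      arrowFunctor (subIncl (monotone_singOf hA) (monotone_singOf hB) fun t => singOf_mono (h t)) ⋙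
        relH k n) := by
  refine relH_iso (F := subspaceFunctor hA) (G := subspaceFunctor hB)
    (F' := subFunctor (monotone_singOf hA)) (G' := subFunctor (monotone_singOf hB))
    { app := fun t => ofSubspace (A t) } { app := fun t => ofSubspace (B t) } rfl (fun t => ?_)
    (fun t => mono_subIncl_app _ _ _ t) (fun t => hIso_of_isIso k (ofSubspace (A t)))
    (fun t => hIso_of_isIso k (ofSubspace (B t))) n
  have : Mono (ofSubspace (A t) ≫ SSet.Subcomplex.homOfLE (singOf_mono (h t))) := mono_comp _ _
  have key {X Y W : SSet.{0}} (f : X ⟶ Y) (g : Y ⟶ W) (i : X ⟶ W) (hi : Mono i) (w : f ≫ g = i) :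
      Mono f := mono_of_mono_fac w
  exact key _ (ofSubspace (B t)) _ this rfl

lemma relH_iso_singSmall (k : Type u) [Field k] {Z : Type} {R R' : T → Z → E → Prop}
    (hR : Monotone R) (hR' : Monotone R') (h : ∀ t, R t ≤ R' t)
    (ho : ∀ t z, IsOpen {y | R t z y}) (ho' : ∀ t z, IsOpen {y | R' t z y})
    {A B : T → Set E} (hA : Monotone A) (hB : Monotone B) (hAB : ∀ t, A t ⊆ B t)
    (hRA : ∀ t y, (∃ z, R t z y) ↔ y ∈ A t) (hRB : ∀ t y, (∃ z, R' t z y) ↔ y ∈ B t) (n : ℕ) :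
    Nonempty (arrowFunctor (subIncl (A := fun t => singSmall (R t)) (B := fun t => singSmall (R' t))
        (fun _ _ hab => singSmall_mono (hR hab)) (fun _ _ hab => singSmall_mono (hR' hab))
        fun t => singSmall_mono (h t)) ⋙ relH k n ≅
      arrowFunctor (subIncl (monotone_singOf hA) (monotone_singOf hB) fun t => singOf_mono (hAB t)) ⋙
        relH k n) := by
  obtain rfl : A = fun t => {y | ∃ z, R t z y} := funext fun t => Set.ext fun y => (hRA t y).symm
  obtain rfl : B = fun t => {y | ∃ z, R' t z y} := funext fun t => Set.ext fun y => (hRB t y).symm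
  exact relH_iso (subIncl _ _ fun t => singSmall_le (R t)) (subIncl _ _ fun t => singSmall_le (R' t))
    rfl (fun t => mono_subIncl_app _ _ _ t) (fun t => mono_subIncl_app _ _ _ t)
    (fun t => hIso_homOfLE_singSmall k (ho t)) (fun t => hIso_homOfLE_singSmall k (ho' t)) n

end Subspaces

/-! ### Straight line retractions and the nerve theorem. -/

section Retraction

variable {E F : Type} [TopologicalSpace F]

section

variable [TopologicalSpace E] {A : Set E} {B : Set F}

/-- The map induced by a continuous map on singular simplices in subsets. -/
def singOfMap (f : C(E, F)) (hf : Set.MapsTo f A B) :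
    (singOf A : SSet.{0}) ⟶ (singOf B : SSet.{0}) where
  app n := TypeCat.ofHom fun σ => ⟨((TopCat.of F).toSSetObjEquiv n).symm (f.comp (singMap σ.1)),
    fun w => hf (σ.2 w)⟩

end

variable [NormedAddCommGroup E] [NormedSpace ℝ E] {A : Set E} {B : Set F}

/-- The straight line between two continuous images of a simplex, with parameter `weight τ`. -/
def lineBetween {n : SimplexCategoryᵒᵖ} (f : C(E, E)) (σ : (Sing E).obj n)
    (τ : (Δ[1] : SSet.{0}).obj n) : (Sing E).obj n :=
  ((TopCat.of E).toSSetObjEquiv n).symm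
    ((1 - weight τ) • f.comp (singMap σ) + weight τ • singMap σ)

lemma singMap_lineBetween {n : SimplexCategoryᵒᵖ} (f : C(E, E)) (σ : (Sing E).obj n)
    (τ : (Δ[1] : SSet.{0}).obj n) (w : stdSimplex ℝ (Fin (n.unop.len + 1))) :
    singMap (lineBetween f σ τ) w = (1 - weight τ w) • f (singMap σ w) + weight τ w • singMap σ w :=
  rfl

open MonoidalCategory in
/-- The straight line homotopy for a section of a continuous map. -/
def retractionHomotopy (f : C(E, F)) (g : C(F, E)) (hf : Set.MapsTo f A B) (hg : Set.MapsTo g B A)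
    (h : ∀ x ∈ A, ∀ r ∈ Set.Icc (0 : ℝ) 1, (1 - r) • g (f x) + r • x ∈ A) :
    SSet.Homotopy (singOfMap f hf ≫ singOfMap g hg) (𝟙 (singOf A : SSet.{0})) where
  h :=
    { app := fun n => TypeCat.ofHom fun x => ⟨lineBetween (g.comp f) x.1.1 x.2, fun w =>
        h _ (x.1.2 w) _ (weight_mem x.2 w)⟩
      naturality := fun m n f' => by
        ext x
        refine Subtype.ext (sing_ext fun w => ?_)
        change singMap (lineBetween _ ((Sing E).map f' x.1.1) ((Δ[1] : SSet.{0}).map f' x.2)) w =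
          singMap (lineBetween _ x.1.1 x.2) (stdSimplex.map f'.unop w)
        rw [singMap_lineBetween, singMap_lineBetween, weight_map, singMap_map] }
  h₀ := by
    ext n σ
    refine Subtype.ext (sing_ext fun w => ?_)
    change singMap (lineBetween _ σ.1 _) w = g (f (singMap σ.1 w))
    rw [singMap_lineBetween]
    have : weight (SSet.stdSimplex.objEquiv.symm (SimplexCategory.const n.unop ⦋1⦌ 0)) w = 0 := by
      simp [weight, affineMap, bit]
    erw [this]
    simp
  h₁ := by
    ext n σ
    refine Subtype.ext (sing_ext fun w => ?_)
    change singMap (lineBetween _ σ.1 _) w = singMap σ.1 w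
    rw [singMap_lineBetween]
    have : weight (SSet.stdSimplex.objEquiv.symm (SimplexCategory.const n.unop ⦋1⦌ 1)) w = 1 := by
      simp [weight, affineMap, bit]
    erw [this]
    simp
  rel := by ext _ ⟨⟨_, ⟨⟩⟩, _⟩

variable (k : Type u) [Field k]

lemma hIso_singOfMap (f : C(E, F)) (g : C(F, E)) (hf : Set.MapsTo f A B) (hg : Set.MapsTo g B A)
    (hfg : ∀ y ∈ B, f (g y) = y)
    (h : ∀ x ∈ A, ∀ r ∈ Set.Icc (0 : ℝ) 1, (1 - r) • g (f x) + r • x ∈ A) :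
    HIso k (singOfMap f hf) := by
  refine hIso_of_homotopy k (g := singOfMap g hg) (retractionHomotopy f g hf hg h) ?_
  ext n σ
  exact Subtype.ext (sing_ext fun w => hfg _ (σ.2 w))

lemma hIso_terminal_singOf (hA : A = Set.univ) :
    HIso k (SSet.stdSimplex.isTerminalObj₀.from (singOf A : SSet.{0})) := by
  subst hA
  have h1 := hIso_singOfMap k (A := (Set.univ : Set E)) (B := (Set.univ : Set Unit))
    (ContinuousMap.const E ()) (ContinuousMap.const Unit 0) (fun _ _ => trivial) (fun _ _ => trivial)
    (fun _ _ => rfl) fun _ _ _ _ => trivial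
  have h2 : IsIso (SSet.stdSimplex.isTerminalObj₀.from
      (singOf (Set.univ : Set Unit) : SSet.{0})) := by
    rw [NatTrans.isIso_iff_isIso_app]
    intro n
    rw [isIso_iff_bijective]
    constructor
    · intro σ τ _
      exact Subtype.ext (sing_ext fun w => rfl)
    · intro y
      refine ⟨⟨((TopCat.of Unit).toSSetObjEquiv n).symm (ContinuousMap.const _ ()),
        fun _ => trivial⟩, ?_⟩
      apply SSet.stdSimplex.objEquiv.injective
      ext i
      exact congrArg Fin.val (Subsingleton.elim (α := Fin 1) _ _)
  have h3 := hIso_comp k h1 (hIso_of_isIso k (SSet.stdSimplex.isTerminalObj₀.from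
      (singOf (Set.univ : Set Unit) : SSet.{0})))
  convert h3 using 2
  exact SSet.stdSimplex.isTerminalObj₀.hom_ext _ _

/-- The nerve of an open cover of a vector space by convex sets is acyclic. -/
theorem hIso_terminal_nerveOf {Z : Type} {R : Z → E → Prop} (ho : ∀ z, IsOpen {y | R z y})
    (hc : ∀ z, Convex ℝ {y | R z y}) (h : ∀ y, ∃ z, R z y) :
    HIso k (SSet.stdSimplex.isTerminalObj₀.from (toSSet (nerveOf R))) := by
  have ht {S S' : SSet.{0}} (f : S ⟶ S') : f ≫ SSet.stdSimplex.isTerminalObj₀.from S' =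
      SSet.stdSimplex.isTerminalObj₀.from S := SSet.stdSimplex.isTerminalObj₀.hom_ext _ _
  -- Acyclicity is carried from the contractible space to small simplices, to the nerve on points,
  -- to the join complex, and finally to the nerve on `Z`.
  have h1 := hIso_comp k (hIso_homOfLE_singSmall k ho)
    (hIso_terminal_singOf k (Set.eq_univ_of_forall h))
  rw [ht] at h1
  have h2 := hIso_of_comp_left k (hIso_toVertices k hc)
    (g := SSet.stdSimplex.isTerminalObj₀.from _) (by rwa [ht])
  have h3 := hIso_of_comp_left k (hIso_inr k R)
    (g := SSet.stdSimplex.isTerminalObj₀.from _) (by rwa [ht])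
  have h4 := hIso_comp k (hIso_inl k R) h3
  rwa [ht] at h4

variable {T : Type} [Preorder T] {Z : Type}

/-- The persistent nerve theorem for pairs of open convex covers. -/
theorem relH_iso_nerve {R R' : T → Z → E → Prop} (hR : Monotone R) (hR' : Monotone R')
    (h : ∀ t, R t ≤ R' t) (ho : ∀ t z, IsOpen {y | R t z y}) (ho' : ∀ t z, IsOpen {y | R' t z y})
    (hc : ∀ t z, Convex ℝ {y | R t z y}) (hc' : ∀ t z, Convex ℝ {y | R' t z y})
    {A B : T → Set E} (hA : Monotone A) (hB : Monotone B) (hAB : ∀ t, A t ⊆ B t)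
    (hRA : ∀ t y, (∃ z, R t z y) ↔ y ∈ A t) (hRB : ∀ t y, (∃ z, R' t z y) ↔ y ∈ B t) (n : ℕ) :
    Nonempty (arrowFunctor (nerveIncl hR hR' h) ⋙ relH k n ≅
      arrowFunctor (subIncl (monotone_singOf hA) (monotone_singOf hB) fun t => singOf_mono (hAB t)) ⋙
        relH k n) := by
  obtain ⟨e₁⟩ := relH_iso_dowker k hR hR' h n
  obtain ⟨e₂⟩ := relH_iso_singSmall k hR hR' h ho ho' hA hB hAB hRA hRB n
  obtain ⟨e₃⟩ := relH_iso (k := k) (α := subIncl (A := fun t => singSmall (R t))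
      (B := fun t => singSmall (R' t)) (fun _ _ hab => singSmall_mono (hR hab))
      (fun _ _ hab => singSmall_mono (hR' hab)) fun t => singSmall_mono (h t))
    (α' := nerveIncl (monotone_flip hR) (monotone_flip hR') fun t y z => h t z y)
    { app := fun t => toVertices (R t) } { app := fun t => toVertices (R' t) } rfl
    (fun t => mono_subIncl_app _ _ _ t) (fun t => mono_inclSSet (nerveOf_mono fun y z => h t z y))
    (fun t => hIso_toVertices k (hc t)) (fun t => hIso_toVertices k (hc' t)) n
  exact ⟨e₁ ≪≫ e₃.symm ≪≫ e₂⟩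

end Retraction

/-! ### Voronoi cells, admissible thickenings and the lift to one more dimension. -/

section VoronoiGeometry

variable {d : ℕ} {X : Set (EuclideanSpace ℝ (Fin d))} {ε : ℝ}

lemma dist_sq_sub_dist_sq (x y q : EuclideanSpace ℝ (Fin d)) :
    dist y q ^ 2 - dist x q ^ 2 = ‖y‖ ^ 2 - ‖x‖ ^ 2 - 2 * inner ℝ (y - x) q := by
  rw [dist_eq_norm, dist_eq_norm, norm_sub_sq_real, norm_sub_sq_real, inner_sub_left]
  ring

/-- The quadratic terms in the moving point cancel, so the difference of squared distances to two
sites is affine. Convexity of Voronoi cells and star-shapedness of the fibres both rest on this. -/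
lemma dist_sq_sub_dist_sq_combination (x y p q : EuclideanSpace ℝ (Fin d)) (r : ℝ) :
    dist y ((1 - r) • p + r • q) ^ 2 - dist x ((1 - r) • p + r • q) ^ 2 =
      (1 - r) * (dist y p ^ 2 - dist x p ^ 2) + r * (dist y q ^ 2 - dist x q ^ 2) := by
  rw [dist_sq_sub_dist_sq, dist_sq_sub_dist_sq, dist_sq_sub_dist_sq, inner_add_right,
    inner_smul_right, inner_smul_right]
  ring

lemma convex_vor (x : EuclideanSpace ℝ (Fin d)) : Convex ℝ (vor X x) := by
  intro p hp q hq a b ha hb hab y hy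
  obtain rfl : a = 1 - b := by linarith
  have h := dist_sq_sub_dist_sq_combination x y p q b
  have h1 := pow_le_pow_left₀ dist_nonneg (hp y hy) 2
  have h2 := pow_le_pow_left₀ dist_nonneg (hq y hy) 2
  have h3 := mul_nonneg ha (sub_nonneg.2 h1)
  have h4 := mul_nonneg hb (sub_nonneg.2 h2)
  refine le_of_sq_le_sq ?_ dist_nonneg
  linarith

lemma exists_mem_vor (hX : X.Finite) (hne : X.Nonempty) (p : EuclideanSpace ℝ (Fin d)) :
    ∃ x ∈ X, p ∈ vor X x := by
  obtain ⟨x, hx, h⟩ := X.exists_min_image (fun x => dist x p) hX hne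
  exact ⟨x, hx, h⟩

/-- A common point of the thickened cells gives $\varepsilon_\sigma\le\varepsilon$, whereas a
non-Delaunay simplex has $\varepsilon_\sigma>2\varepsilon$. Thickened cells therefore have the same
nerve as the cells themselves. -/
lemma mem_delaunayComplex_of_thickening (hε : IsAdmissible X ε) {σ : Finset X} (hσ : σ.Nonempty)
    {p : EuclideanSpace ℝ (Fin d)} (hp : ∀ x ∈ σ, p ∈ Metric.thickening ε (vor X x)) :
    σ ∈ delaunayComplex X := by
  by_contra h
  have h1 : 2 * ENNReal.ofReal ε < ENNReal.ofReal ε :=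
    ((hε.2 σ hσ h).trans_le (iInf_le _ p)).trans_le
      (iSup₂_le fun x hx => (Metric.mem_thickening_iff_infEDist_lt.1 (hp x hx)).le)
  refine h1.not_ge ?_
  rw [two_mul]
  exact le_self_add

lemma lt_ofReal_of_hMap_lt {u : ℝ≥0∞} {t : ℝ} (h : hMap ε u < ENNReal.ofReal t) :
    u < ENNReal.ofReal ε := by
  by_contra h'
  rw [hMap, if_neg h'] at h
  exact not_top_lt h

lemma hMap_zero (hε : 0 < ε) : hMap ε 0 = 0 := by
  rw [hMap, if_pos (ENNReal.ofReal_pos.2 hε)]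
  simp

lemma pr_lift (a : ℝ) (x : EuclideanSpace ℝ (Fin d)) : pr (lift a x) = x := by
  ext i
  simp [pr, lift]

lemma lift_last (a : ℝ) (x : EuclideanSpace ℝ (Fin d)) : lift a x (Fin.last d) = a := by
  simp [lift]

lemma lift_injective (a : ℝ) : Function.Injective (lift (d := d) a) :=
  Function.LeftInverse.injective (pr_lift a)

lemma dist_sq_eq_pr_add (z q : EuclideanSpace ℝ (Fin (d + 1))) :
    dist z q ^ 2 = dist (pr z) (pr q) ^ 2 + (z (Fin.last d) - q (Fin.last d)) ^ 2 := by
  rw [EuclideanSpace.dist_sq_eq, EuclideanSpace.dist_sq_eq, Fin.sum_univ_castSucc, Real.dist_eq,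
    sq_abs]
  rfl

lemma continuous_lift (a : ℝ) : Continuous (lift (d := d) a) := by
  refine (PiLp.continuous_toLp 2 _).comp (continuous_pi fun i => ?_)
  refine Fin.lastCases ?_ (fun i => ?_) i
  · simpa using continuous_const
  · simp only [Fin.snoc_castSucc]
    exact (continuous_apply i).comp (PiLp.continuous_ofLp 2 _)

end VoronoiGeometry

/-! ### The convex open cells over the lifted points, and their nerves. -/

section Cells

variable {d : ℕ} (X₁ X₂ : Set (EuclideanSpace ℝ (Fin d))) (s ε : ℝ)

/-- The relation given by the thickened lifted Voronoi cells and the balls of radius `t`. -/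
def cellRel (t : ℝ) (z : liftedPair X₁ X₂ s)
    (y : EuclideanSpace ℝ (Fin d) × EuclideanSpace ℝ (Fin (d + 1))) : Prop :=
  dist (pr z) y.1 < t ∧ y.2 ∈ Metric.thickening ε (vor (liftedPair X₁ X₂ s) z)

/-- The restriction of `cellRel` to the points coming from `X₁`. -/
def cellRel₁ (t : ℝ) (z : liftedPair X₁ X₂ s)
    (y : EuclideanSpace ℝ (Fin d) × EuclideanSpace ℝ (Fin (d + 1))) : Prop :=
  z ∈ Set.range (j₁ X₁ X₂ s) ∧ cellRel X₁ X₂ s ε t z y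

variable {X₁ X₂ s ε}

lemma cellRel_mono {t t' : ℝ} (h : t ≤ t') : cellRel X₁ X₂ s ε t ≤ cellRel X₁ X₂ s ε t' :=
  fun _ _ hy => ⟨hy.1.trans_le h, hy.2⟩

lemma cellRel₁_mono {t t' : ℝ} (h : t ≤ t') : cellRel₁ X₁ X₂ s ε t ≤ cellRel₁ X₁ X₂ s ε t' :=
  fun _ _ hy => ⟨hy.1, cellRel_mono h _ _ hy.2⟩

lemma cellRel₁_le (t : ℝ) : cellRel₁ X₁ X₂ s ε t ≤ cellRel X₁ X₂ s ε t := fun _ _ hy => hy.2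

lemma setOf_cellRel (t : ℝ) (z : liftedPair X₁ X₂ s) : {y | cellRel X₁ X₂ s ε t z y} =
    Metric.ball (pr z) t ×ˢ Metric.thickening ε (vor (liftedPair X₁ X₂ s) z) := by
  ext y
  rw [Set.mem_prod, Metric.mem_ball']
  rfl

lemma isOpen_cellRel (t : ℝ) (z : liftedPair X₁ X₂ s) : IsOpen {y | cellRel X₁ X₂ s ε t z y} := by
  rw [setOf_cellRel]
  exact Metric.isOpen_ball.prod Metric.isOpen_thickening

lemma convex_cellRel (t : ℝ) (z : liftedPair X₁ X₂ s) :
    Convex ℝ {y | cellRel X₁ X₂ s ε t z y} := by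
  rw [setOf_cellRel]
  exact (convex_ball _ _).prod ((convex_vor _).thickening _)

lemma isOpen_cellRel₁ (t : ℝ) (z : liftedPair X₁ X₂ s) : IsOpen {y | cellRel₁ X₁ X₂ s ε t z y} :=
  isOpen_const.inter (isOpen_cellRel t z)

lemma convex_cellRel₁ (t : ℝ) (z : liftedPair X₁ X₂ s) :
    Convex ℝ {y | cellRel₁ X₁ X₂ s ε t z y} := by
  by_cases hz : z ∈ Set.range (j₁ X₁ X₂ s)
  · simpa only [cellRel₁, hz, true_and] using convex_cellRel t z
  · simpa only [cellRel₁, hz, false_and] using! convex_empty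

/-- The two coordinates of the witness are independent. A second coordinate in the thickened cells
can be replaced by a point `q` of the cells themselves, where the Delaunay dissimilarity is zero;
only its finiteness matters. -/
lemma dowkerNerve_liftedDissim (hε : IsAdmissible (liftedPair X₁ X₂ s) ε) (t : Set.Ioi (0 : ℝ)) :
    dowkerNerve (liftedDissim X₁ X₂ s ε) t = nerveOf (cellRel X₁ X₂ s ε t) := by
  refine SetLike.ext fun σ => and_congr_right fun hσ => ⟨?_, ?_⟩
  · rintro ⟨y, hy⟩
    refine ⟨y, fun z hz => ?_⟩
    obtain ⟨h1, h2⟩ := max_lt_iff.1 (hy z hz)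
    exact ⟨edist_lt_ofReal.1 h1, lt_ofReal_of_hMap_lt h2⟩
  · rintro ⟨y, hy⟩
    obtain ⟨-, q, hq⟩ := mem_delaunayComplex_of_thickening hε hσ fun z hz => (hy z hz).2
    refine ⟨(y.1, q), fun z hz => max_lt (edist_lt_ofReal.2 (hy z hz).1) ?_⟩
    rw [delaunayDissim, Metric.infEDist_zero_of_mem (hq z hz), hMap_zero hε.1]
    exact ENNReal.ofReal_pos.2 t.2

lemma j₁_injective : Function.Injective (j₁ X₁ X₂ s) := fun _ _ h =>
  Subtype.ext (lift_injective s (congrArg Subtype.val h))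

variable (X₁ X₂ s) in
open Classical in
/-- The Delaunay complex of `X₁` on the vertex set of lifted points. -/
def delaunayImage : PreAbstractSimplicialComplex (liftedPair X₁ X₂ s) :=
  (delaunayComplex X₁).map (j₁ X₁ X₂ s)

lemma mem_delaunayImage {σ : Finset (liftedPair X₁ X₂ s)} : σ ∈ delaunayImage X₁ X₂ s ↔
    σ.Nonempty ∧ ∃ p, ∀ z ∈ σ, ∃ x, j₁ X₁ X₂ s x = z ∧ p ∈ vor X₁ x := by
  classical
  constructor
  · rintro ⟨τ, ⟨hτ, p, hp⟩, rfl⟩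
    refine ⟨hτ.image _, p, fun z hz => ?_⟩
    obtain ⟨x, hx, rfl⟩ := Finset.mem_image.1 hz
    exact ⟨x, rfl, hp x hx⟩
  · rintro ⟨hσ, p, hp⟩
    have : Nonempty X₁ := hσ.elim fun z hz => ⟨(hp z hz).choose⟩
    choose! f hf using hp
    have h : (σ.image f).image (j₁ X₁ X₂ s) = σ := by
      rw [Finset.image_image]
      exact (Finset.image_congr fun z hz => (hf z hz).1).trans Finset.image_id
    refine ⟨σ.image f, ⟨hσ.image _, p, fun x hx => ?_⟩, ?_⟩
    · obtain ⟨z, hz, rfl⟩ := Finset.mem_image.1 hx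
      exact (hf z hz).2
    · convert h

variable (X₁ X₂ s) in
/-- The relation given by the thickened Voronoi cells of `X₁`. -/
def vorRel (ε₁ : ℝ) (z : liftedPair X₁ X₂ s) (p : EuclideanSpace ℝ (Fin d)) : Prop :=
  ∃ x, j₁ X₁ X₂ s x = z ∧ p ∈ Metric.thickening ε₁ (vor X₁ x)

lemma delaunayImage_eq {ε₁ : ℝ} (hε₁ : IsAdmissible X₁ ε₁) :
    delaunayImage X₁ X₂ s = nerveOf (vorRel X₁ X₂ s ε₁) := by
  classical
  refine SetLike.ext fun σ => mem_delaunayImage.trans (and_congr_right fun hσ => ⟨?_, ?_⟩)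
  · rintro ⟨p, hp⟩
    refine ⟨p, fun z hz => ?_⟩
    obtain ⟨x, hx, h⟩ := hp z hz
    exact ⟨x, hx, Metric.self_subset_thickening hε₁.1 _ h⟩
  · rintro ⟨p, hp⟩
    have : Nonempty X₁ := hσ.elim fun z hz => ⟨(hp z hz).choose⟩
    choose! f hf using hp
    obtain ⟨-, q, hq⟩ := mem_delaunayComplex_of_thickening hε₁ (hσ.image f) (p := p) (by
      intro x hx
      obtain ⟨z, hz, rfl⟩ := Finset.mem_image.1 hx
      exact (hf z hz).2)
    exact ⟨q, fun z hz => ⟨f z, (hf z hz).1, hq _ (Finset.mem_image_of_mem f hz)⟩⟩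

lemma setOf_vorRel {ε₁ : ℝ} (x : X₁) :
    {p | vorRel X₁ X₂ s ε₁ (j₁ X₁ X₂ s x) p} = Metric.thickening ε₁ (vor X₁ x) := by
  ext p
  constructor
  · rintro ⟨y, hy, h⟩
    rwa [← j₁_injective hy]
  · exact fun h => ⟨x, rfl, h⟩

lemma setOf_vorRel_of_notMem {ε₁ : ℝ} {z : liftedPair X₁ X₂ s}
    (hz : z ∉ Set.range (j₁ X₁ X₂ s)) : {p | vorRel X₁ X₂ s ε₁ z p} = ∅ :=
  Set.eq_empty_of_forall_notMem fun _ ⟨x, hx, _⟩ => hz ⟨x, hx⟩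

/-- By admissibility this complex is the nerve of the thickened Voronoi cells of `X₁`, which are
open, convex and cover $\mathbb{R}^d$. Vertices not coming from `X₁` receive empty cells. -/
theorem hIso_terminal_delaunayImage (k : Type u) [Field k] {ε₁ : ℝ} (hε₁ : IsAdmissible X₁ ε₁)
    (hX₁ : X₁.Finite) (hne : X₁.Nonempty) :
    HIso k (SSet.stdSimplex.isTerminalObj₀.from (toSSet (delaunayImage X₁ X₂ s))) := by
  rw [delaunayImage_eq hε₁]
  apply hIso_terminal_nerveOf
  · intro z
    by_cases hz : z ∈ Set.range (j₁ X₁ X₂ s)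
    · obtain ⟨x, rfl⟩ := hz
      rw [setOf_vorRel]
      exact Metric.isOpen_thickening
    · rw [setOf_vorRel_of_notMem hz]
      exact isOpen_empty
  · intro z
    by_cases hz : z ∈ Set.range (j₁ X₁ X₂ s)
    · obtain ⟨x, rfl⟩ := hz
      rw [setOf_vorRel]
      exact (convex_vor _).thickening _
    · rw [setOf_vorRel_of_notMem hz]
      exact convex_empty
  · intro p
    obtain ⟨x, hx, h⟩ := exists_mem_vor hX₁ hne p
    exact ⟨_, ⟨x, hx⟩, rfl, Metric.self_subset_thickening hε₁.1 _ h⟩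

/-- A common point `q` of Voronoi cells of `Z` projects to a common point of Voronoi cells of `X₁`:
all lifted points of `X₁` have height `s`, so the last coordinate contributes equally to their
distances from `q`. -/
lemma nerveOf_cellRel₁_le_delaunayImage (hε : IsAdmissible (liftedPair X₁ X₂ s) ε) (t : ℝ) :
    nerveOf (cellRel₁ X₁ X₂ s ε t) ≤ delaunayImage X₁ X₂ s := by
  rintro σ ⟨hσ, y, hy⟩
  obtain ⟨-, q, hq⟩ := mem_delaunayComplex_of_thickening hε hσ fun z hz => (hy z hz).2.2
  refine mem_delaunayImage.2 ⟨hσ, pr q, fun z hz => ?_⟩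
  obtain ⟨x, rfl⟩ := (hy z hz).1
  refine ⟨x, rfl, fun x' hx' => ?_⟩
  have h := pow_le_pow_left₀ dist_nonneg (hq _ hz (lift s x') (Or.inl ⟨x', hx', rfl⟩)) 2
  rw [dist_sq_eq_pr_add, dist_sq_eq_pr_add (lift s x')] at h
  simp only [j₁, pr_lift, lift_last, add_le_add_iff_right] at h
  exact le_of_sq_le_sq h dist_nonneg

/-- With the preceding inclusion, this identifies the intersection of the two pieces of the relative
Delaunay–Čech complex, as excision requires. -/
lemma mem_nerveOf_cellRel₁ {t : ℝ} {σ : Finset (liftedPair X₁ X₂ s)}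
    (h : σ ∈ nerveOf (cellRel X₁ X₂ s ε t)) (h' : σ ∈ delaunayImage X₁ X₂ s) :
    σ ∈ nerveOf (cellRel₁ X₁ X₂ s ε t) := by
  obtain ⟨hσ, y, hy⟩ := h
  obtain ⟨-, p, hp⟩ := mem_delaunayImage.1 h'
  refine ⟨hσ, y, fun z hz => ⟨?_, hy z hz⟩⟩
  obtain ⟨x, hx, -⟩ := hp z hz
  exact ⟨x, hx⟩

end Cells

/-! ### The fibres of the projection to $\mathbb{R}^d$ are star-shaped. -/

section Fibres

variable {d : ℕ} {X₁ X₂ : Set (EuclideanSpace ℝ (Fin d))} {s ε : ℝ}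

/-- Near the centre `lift a p`, the points of `Z` whose projection has distance less than `t` from
`p` and which come from `X₁` if `b` holds are a lower set for the distance to the centre. -/
def IsCentre (X₁ X₂ : Set (EuclideanSpace ℝ (Fin d))) (s t a : ℝ) (P : liftedPair X₁ X₂ s → Prop) :
    Prop :=
  ∀ (p : EuclideanSpace ℝ (Fin d)) (z z' : liftedPair X₁ X₂ s), P z → dist (pr z) p < t →
    dist (z' : EuclideanSpace ℝ (Fin (d + 1))) (lift a p) ≤ dist z.1 (lift a p) →
      P z' ∧ dist (pr z') p < t

lemma last_sq (z : liftedPair X₁ X₂ s) : z.1 (Fin.last d) ^ 2 = s ^ 2 := by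
  obtain ⟨_, ⟨x, hx, rfl⟩ | ⟨x, hx, rfl⟩⟩ := z
  · rw [lift_last]
  · rw [lift_last, neg_sq]

/-- The heights `s` and `-s` are equally far from height zero, so distances to $(p,0)$ are ordered
as the projected distances to $p$. -/
lemma isCentre_zero (t : ℝ) : IsCentre X₁ X₂ s t 0 fun _ => True := by
  intro p z z' _ hz h
  refine ⟨trivial, lt_of_le_of_lt ?_ hz⟩
  replace h := pow_le_pow_left₀ dist_nonneg h 2
  rw [dist_sq_eq_pr_add, dist_sq_eq_pr_add z.1, lift_last, pr_lift, sub_zero, sub_zero, last_sq,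
    last_sq, add_le_add_iff_right] at h
  exact le_of_sq_le_sq h dist_nonneg

/-- The height $a=t^2/4s$ is chosen so that $(s+a)^2-(s-a)^2=4sa=t^2$. A point of height `-s` thus
pays a penalty of $t^2$ in squared distance and loses against any point of `X₁` whose distance from
$p$ is less than $t$. -/
lemma isCentre_of_pos (hs : 0 < s) (t : ℝ) :
    IsCentre X₁ X₂ s t (t ^ 2 / (4 * s)) fun z => z ∈ Set.range (j₁ X₁ X₂ s) := by
  rintro p _ z' ⟨x, rfl⟩ hz h
  set a := t ^ 2 / (4 * s) with ha
  have ha' : 4 * s * a = t ^ 2 := mul_div_cancel₀ _ (by positivity)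
  replace h := pow_le_pow_left₀ dist_nonneg h 2
  rw [dist_sq_eq_pr_add, dist_sq_eq_pr_add (j₁ X₁ X₂ s x).1, lift_last, pr_lift] at h
  simp only [j₁, lift_last] at h hz
  obtain ⟨_, ⟨x', hx', rfl⟩ | ⟨x', hx', rfl⟩⟩ := z'
  · rw [lift_last, add_le_add_iff_right] at h
    exact ⟨⟨⟨x', hx'⟩, rfl⟩, (le_of_sq_le_sq h dist_nonneg).trans_lt hz⟩
  · exfalso
    rw [lift_last] at h
    have h1 := sq_nonneg (dist (pr (lift (-s) x')) p)
    have h2 := pow_lt_pow_left₀ hz dist_nonneg two_ne_zero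
    nlinarith

/-- Let $z'$ be a nearest site to a point on the segment from the centre to `q`. The affine function
$d(z',\cdot)^2-d(z,\cdot)^2$ is at most zero there and at least zero at `q`, hence at most zero at
the centre, and the centre property applies to $z'$. -/
lemma IsCentre.exists_vor {t a : ℝ} {P : liftedPair X₁ X₂ s → Prop} (h : IsCentre X₁ X₂ s t a P)
    (hfin : (liftedPair X₁ X₂ s).Finite) {p : EuclideanSpace ℝ (Fin d)}
    {q : EuclideanSpace ℝ (Fin (d + 1))} {z : liftedPair X₁ X₂ s} (hP : P z)
    (hz : dist (pr z) p < t) (hq : q ∈ vor (liftedPair X₁ X₂ s) z) {r : ℝ}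
    (hr : r ∈ Set.Icc (0 : ℝ) 1) : ∃ z', (P z' ∧ dist (pr z') p < t) ∧
      (1 - r) • lift a p + r • q ∈ vor (liftedPair X₁ X₂ s) z' := by
  -- At `r = 1` the point is `q` itself and yields no information about the centre.
  obtain rfl | hr1 := eq_or_lt_of_le hr.2
  · exact ⟨z, ⟨hP, hz⟩, by simpa using hq⟩
  obtain ⟨z', hz', hv⟩ := exists_mem_vor hfin ⟨z.1, z.2⟩ ((1 - r) • lift a p + r • q)
  refine ⟨⟨z', hz'⟩, h p z ⟨z', hz'⟩ hP hz ?_, hv⟩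
  have h1 := pow_le_pow_left₀ dist_nonneg (hv z z.2) 2
  have h2 := pow_le_pow_left₀ dist_nonneg (hq z' hz') 2
  have h3 := dist_sq_sub_dist_sq_combination z.1 z' (lift a p) q r
  have h4 := mul_nonneg hr.1 (sub_nonneg.2 h2)
  refine le_of_sq_le_sq (sub_nonpos.1 ?_) dist_nonneg
  have h5 : (1 - r) * (dist z' (lift a p) ^ 2 - dist z.1 (lift a p) ^ 2) ≤ 0 := by linarith
  exact nonpos_of_mul_nonpos_right h5 (sub_pos.2 hr1)

/-- The first coordinate stays fixed along the segment. The second is compared with the segment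
ending at a nearby point `q` of the Voronoi cell; their distance is scaled by `r ≤ 1`, so it stays
below `ε`. -/
lemma IsCentre.exists_cellRel {t a : ℝ} {P : liftedPair X₁ X₂ s → Prop}
    (h : IsCentre X₁ X₂ s t a P) (hfin : (liftedPair X₁ X₂ s).Finite)
    {y : EuclideanSpace ℝ (Fin d) × EuclideanSpace ℝ (Fin (d + 1))}
    (hy : ∃ z, P z ∧ cellRel X₁ X₂ s ε t z y) {r : ℝ} (hr : r ∈ Set.Icc (0 : ℝ) 1) :
    ∃ z, P z ∧ cellRel X₁ X₂ s ε t z ((1 - r) • (y.1, lift a y.1) + r • y) := by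
  obtain ⟨z, hP, hz, hq⟩ := hy
  obtain ⟨q, hq, hqy⟩ := Metric.mem_thickening_iff.1 hq
  obtain ⟨z', ⟨hP', hz'⟩, hv⟩ := h.exists_vor hfin hP hz hq hr
  refine ⟨z', hP', ?_, Metric.mem_thickening_iff.2 ⟨_, hv, ?_⟩⟩
  · have : (1 - r) • y.1 + r • y.1 = y.1 := by rw [← add_smul, sub_add_cancel, one_smul]
    simpa [this] using hz'
  · refine lt_of_le_of_lt ?_ hqy
    simp only [Prod.snd_add, Prod.smul_snd, dist_add_left, dist_smul₀]
    rw [Real.norm_of_nonneg hr.1]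
    exact mul_le_of_le_one_left dist_nonneg hr.2

lemma IsCentre.exists_cellRel_lift {t a : ℝ} {P : liftedPair X₁ X₂ s → Prop}
    (h : IsCentre X₁ X₂ s t a P) (hfin : (liftedPair X₁ X₂ s).Finite) (hε : 0 < ε)
    {p : EuclideanSpace ℝ (Fin d)} (hp : ∃ z : liftedPair X₁ X₂ s, P z ∧ dist (pr z) p < t) :
    ∃ z, P z ∧ cellRel X₁ X₂ s ε t z (p, lift a p) := by
  obtain ⟨z, hP, hz⟩ := hp
  obtain ⟨z', hz', hv⟩ := exists_mem_vor hfin ⟨z.1, z.2⟩ (lift a p)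
  obtain ⟨hP', h'⟩ := h p z ⟨z', hz'⟩ hP hz (hv z z.2)
  exact ⟨⟨z', hz'⟩, hP', h', Metric.self_subset_thickening hε _ hv⟩

variable (k : Type u) [Field k]

/-- The section $p\mapsto(p,\mathrm{lift}_a(p))$ picks the centres, and each fibre retracts to its
centre along straight lines. -/
lemma hIso_fst {t a : ℝ} {P : liftedPair X₁ X₂ s → Prop} (h : IsCentre X₁ X₂ s t a P)
    (hfin : (liftedPair X₁ X₂ s).Finite) (hε : 0 < ε)
    {U : Set (EuclideanSpace ℝ (Fin d) × EuclideanSpace ℝ (Fin (d + 1)))}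
    (hU : ∀ y, y ∈ U ↔ ∃ z, P z ∧ cellRel X₁ X₂ s ε t z y) {B : Set (EuclideanSpace ℝ (Fin d))}
    (hB : ∀ p, p ∈ B ↔ ∃ z : liftedPair X₁ X₂ s, P z ∧ dist (pr z) p < t)
    (hUB : Set.MapsTo Prod.fst U B) :
    HIso k (singOfMap ⟨Prod.fst, continuous_fst⟩ hUB) := by
  refine hIso_singOfMap k _ ⟨fun p => (p, lift a p), continuous_id.prodMk (continuous_lift a)⟩ _
    (fun p hp => (hU _).2 (h.exists_cellRel_lift hfin hε ((hB p).1 hp))) (fun _ _ => rfl) ?_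
  exact fun y hy r hr => (hU _).2 (h.exists_cellRel hfin ((hU y).1 hy) hr)

lemma mem_thickening_iff_liftedPair {t : ℝ} (p : EuclideanSpace ℝ (Fin d)) :
    p ∈ Metric.thickening t (X₁ ∪ X₂) ↔
      ∃ z : liftedPair X₁ X₂ s, True ∧ dist (pr z) p < t := by
  rw [Metric.mem_thickening_iff]
  constructor
  · rintro ⟨x, hx | hx, h⟩
    · exact ⟨⟨_, Or.inl ⟨x, hx, rfl⟩⟩, trivial, by rwa [pr_lift, dist_comm]⟩
    · exact ⟨⟨_, Or.inr ⟨x, hx, rfl⟩⟩, trivial, by rwa [pr_lift, dist_comm]⟩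
  · rintro ⟨⟨_, ⟨x, hx, rfl⟩ | ⟨x, hx, rfl⟩⟩, -, h⟩
    · exact ⟨x, Or.inl hx, by rwa [pr_lift, dist_comm] at h⟩
    · exact ⟨x, Or.inr hx, by rwa [pr_lift, dist_comm] at h⟩

lemma mem_thickening_iff_range {t : ℝ} (p : EuclideanSpace ℝ (Fin d)) :
    p ∈ Metric.thickening t X₁ ↔
      ∃ z : liftedPair X₁ X₂ s, z ∈ Set.range (j₁ X₁ X₂ s) ∧ dist (pr z) p < t := by
  rw [Metric.mem_thickening_iff]
  constructor
  · rintro ⟨x, hx, h⟩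
    exact ⟨_, ⟨⟨x, hx⟩, rfl⟩, by rwa [j₁, pr_lift, dist_comm]⟩
  · rintro ⟨_, ⟨x, rfl⟩, h⟩
    exact ⟨x, x.2, by rwa [j₁, pr_lift, dist_comm] at h⟩

end Fibres

/-! ### From nerves of cells to Euclidean thickenings. -/

section Thickenings

variable (k : Type u) [Field k] {d : ℕ} {X₁ X₂ : Set (EuclideanSpace ℝ (Fin d))} {s ε : ℝ}

lemma monotone_thickening (A : Set (EuclideanSpace ℝ (Fin d))) :
    Monotone fun t : Set.Ioi (0 : ℝ) => Metric.thickening (t : ℝ) A :=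
  fun _ _ h => Metric.thickening_mono h A

/-- The relative homology of thickenings in terms of singular simplicial sets. -/
def thickeningIso {A X : Set (EuclideanSpace ℝ (Fin d))} (h : A ⊆ X) (n : ℕ) :
    thickeningRelativeHomology k h n ≅
      arrowFunctor (subspaceIncl (monotone_thickening A) (monotone_thickening X)
        fun t => Metric.thickening_subset_of_subset (t : ℝ) h) ⋙ relH k n :=
  NatIso.ofComponents (fun _ => Iso.refl _) fun _ =>
    (Category.comp_id _).trans (Category.id_comp _).symm

lemma monotone_cellRel :
    Monotone fun t : Set.Ioi (0 : ℝ) => cellRel X₁ X₂ s ε t :=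
  fun _ _ h => cellRel_mono h

lemma monotone_cellRel₁ :
    Monotone fun t : Set.Ioi (0 : ℝ) => cellRel₁ X₁ X₂ s ε t :=
  fun _ _ h => cellRel₁_mono h

theorem relH_iso_thickening (hX₁ : X₁.Finite) (hX₂ : X₂.Finite) (hs : 0 < s) (hε : 0 < ε) (n : ℕ) :
    Nonempty (arrowFunctor (nerveIncl (monotone_cellRel₁ (X₁ := X₁) (X₂ := X₂) (s := s) (ε := ε))
        monotone_cellRel fun t => cellRel₁_le (t : ℝ)) ⋙ relH k n ≅
      thickeningRelativeHomology k (Set.subset_union_left : X₁ ⊆ X₁ ∪ X₂) n) := by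
  have hfin : (liftedPair X₁ X₂ s).Finite := (hX₁.image _).union (hX₂.image _)
  have hA : Monotone fun t : Set.Ioi (0 : ℝ) => {y | ∃ z, cellRel₁ X₁ X₂ s ε t z y} :=
    fun _ _ h y ⟨z, hz⟩ => ⟨z, cellRel₁_mono h z y hz⟩
  have hB : Monotone fun t : Set.Ioi (0 : ℝ) => {y | ∃ z, cellRel X₁ X₂ s ε t z y} :=
    fun _ _ h y ⟨z, hz⟩ => ⟨z, cellRel_mono h z y hz⟩
  have hAB (t : Set.Ioi (0 : ℝ)) :
      {y | ∃ z, cellRel₁ X₁ X₂ s ε t z y} ⊆ {y | ∃ z, cellRel X₁ X₂ s ε t z y} :=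
    fun y ⟨z, hz⟩ => ⟨z, hz.2⟩
  obtain ⟨e₁⟩ := relH_iso_nerve k (monotone_cellRel₁ (X₁ := X₁) (X₂ := X₂) (s := s) (ε := ε))
    monotone_cellRel (fun t => cellRel₁_le (t : ℝ)) (fun t => isOpen_cellRel₁ (t : ℝ))
    (fun t => isOpen_cellRel (t : ℝ)) (fun t => convex_cellRel₁ (t : ℝ))
    (fun t => convex_cellRel (t : ℝ)) hA hB hAB (fun _ _ => Iff.rfl) (fun _ _ => Iff.rfl) n
  have m₁ (t : Set.Ioi (0 : ℝ)) : Set.MapsTo Prod.fst {y | ∃ z, cellRel₁ X₁ X₂ s ε t z y}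
      (Metric.thickening (t : ℝ) X₁) := fun y ⟨z, hz⟩ =>
    (mem_thickening_iff_range (X₂ := X₂) (s := s) _).2 ⟨z, hz.1, hz.2.1⟩
  have m₂ (t : Set.Ioi (0 : ℝ)) : Set.MapsTo Prod.fst {y | ∃ z, cellRel X₁ X₂ s ε t z y}
      (Metric.thickening (t : ℝ) (X₁ ∪ X₂)) := fun y ⟨z, hz⟩ =>
    (mem_thickening_iff_liftedPair (s := s) _).2 ⟨z, trivial, hz.1⟩
  obtain ⟨e₂⟩ := relH_iso (k := k)
    (α := subIncl (monotone_singOf hA) (monotone_singOf hB) fun t => singOf_mono (hAB t))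
    (α' := subIncl (monotone_singOf (monotone_thickening X₁))
      (monotone_singOf (monotone_thickening (X₁ ∪ X₂)))
      fun t => singOf_mono (Metric.thickening_subset_of_subset (t : ℝ) Set.subset_union_left))
    { app := fun t => singOfMap ⟨Prod.fst, continuous_fst⟩ (m₁ t) }
    { app := fun t => singOfMap ⟨Prod.fst, continuous_fst⟩ (m₂ t) } rfl
    (fun t => mono_subIncl_app _ _ _ t) (fun t => mono_subIncl_app _ _ _ t)
    -- The centres differ for the two members of the pair, and here they also vary with `t`. This is
    -- harmless because only the projection has to be natural.
    (fun t => hIso_fst k (isCentre_of_pos hs t) hfin hε (fun _ => Iff.rfl)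
      mem_thickening_iff_range (m₁ t))
    (fun t => hIso_fst k (isCentre_zero t) hfin hε (fun _ => by simp)
      mem_thickening_iff_liftedPair (m₂ t)) n
  obtain ⟨e₃⟩ := relH_iso_subspace k (monotone_thickening X₁) (monotone_thickening (X₁ ∪ X₂))
    (fun t => Metric.thickening_subset_of_subset (t : ℝ) Set.subset_union_left) n
  exact ⟨e₁ ≪≫ e₂ ≪≫ e₃.symm ≪≫ (thickeningIso k _ n).symm⟩

end Thickenings

/-! ### Excision and reduced homology for families of simplicial complexes. -/

section Complexes

lemma comp_comp_eq_of_squares {C : Type*} [Category* C] {X Y Z X' Y' Z' : C} {f : X ⟶ X'}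
    {g : Y ⟶ Y'} {h : Z ⟶ Z'} {i : X ⟶ Y} {i' : X' ⟶ Y'} {j : Y ⟶ Z} {j' : Y' ⟶ Z'}
    (h₁ : f ≫ i' = i ≫ g) (h₂ : g ≫ j' = j ≫ h) : f ≫ i' ≫ j' = (i ≫ j) ≫ h := by
  rw [← Category.assoc, h₁, Category.assoc, h₂, Category.assoc]

variable (k : Type u) [Field k] {T : Type} [Preorder T] {V : Type}
  {A N D K : T → PreAbstractSimplicialComplex V} (hA : Monotone A) (hN : Monotone N)
  (hD : Monotone D) (hK : Monotone K)

lemma relH_iso_of_excision (hAN : ∀ t, A t ≤ N t) (hDK : ∀ t, D t ≤ K t) (hAD : ∀ t, A t ≤ D t)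
    (hNK : ∀ t, N t ≤ K t) (h₁ : ∀ t, ∀ σ ∈ K t, σ ∈ D t ∨ σ ∈ N t)
    (h₂ : ∀ t, ∀ σ ∈ N t, σ ∈ D t → σ ∈ A t) (n : ℕ) :
    Nonempty (arrowFunctor (inclNat hA hN hAN) ⋙ relH k n ≅
      arrowFunctor (inclNat hD hK hDK) ⋙ relH k n) := by
  let φ := arrowFunctorMap (α := inclNat hA hN hAN) (α' := inclNat hD hK hDK) (inclNat hA hD hAD)
    (inclNat hN hK hNK) rfl
  have (t : T) : IsIso ((relH k n).map (φ.app t)) := by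
    have : Mono ((arrowFunctor (inclNat hA hN hAN)).obj t).hom := mono_inclSSet (hAN t)
    have : Mono ((arrowFunctor (inclNat hD hK hDK)).obj t).hom := mono_inclSSet (hDK t)
    refine isIso_relH_map_of_excision (φ.app t) (fun m x y hxy => ?_) (fun m x => ?_)
      (fun m x hx => ?_) n
    · exact Subtype.ext (congrArg (fun z : (toSSet (K t)).obj m => z.1) hxy)
    · exact (h₁ t _ x.2).imp (fun h => ⟨⟨x.1, h⟩, rfl⟩) fun h => ⟨⟨x.1, h⟩, rfl⟩
    · obtain ⟨y, hy⟩ := hx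
      have hy' : y.1 = x.1 := congrArg (fun z : (toSSet (K t)).obj m => z.1) hy
      have hxD := y.2
      rw [hy'] at hxD
      exact ⟨⟨x.1, h₂ t _ x.2 hxD⟩, rfl⟩
  exact ⟨NatIso.ofComponents (fun t => @asIso _ _ _ _ _ (this t)) fun i => by
    simp only [Functor.comp_map, asIso_hom, ← Functor.map_comp, NatTrans.naturality]⟩

lemma reduced_iso_relH (hDK : ∀ t, D t ≤ K t)
    (h : ∀ t, HIso k (SSet.stdSimplex.isTerminalObj₀.from (toSSet (D t)))) (n : ℕ) :
    Nonempty (cxFunctor hK ⋙ reducedHomologyFunctor k n ≅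
      arrowFunctor (inclNat hD hK hDK) ⋙ relH k n) := by
  have (t : T) :=
    have : Mono ((arrowFunctor (inclNat hD hK hDK)).obj t).hom := mono_inclSSet (hDK t)
    isIso_reduced_toRelH ((arrowFunctor (inclNat hD hK hDK)).obj t) (h t) n
  refine ⟨NatIso.ofComponents (fun t => @asIso _ _ _ _ _ (this t)) fun {a b} i => ?_⟩
  have h2 := (toRelH (k := k) n).naturality ((arrowFunctor (inclNat hD hK hDK)).map i)
  have h3 : (cxFunctor hK ⋙ reducedHomologyFunctor k n).map i ≫ kernel.ι (SSet.homologyMap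
      (SSet.stdSimplex.isTerminalObj₀.from (toSSet (K b))) (ModuleCat.of k k) n) =
      kernel.ι (SSet.homologyMap (SSet.stdSimplex.isTerminalObj₀.from (toSSet (K a)))
        (ModuleCat.of k k) n) ≫ SSet.homologyMap ((cxFunctor hK).map i) (ModuleCat.of k k) n :=
    kernel.lift_ι _ _ _
  exact comp_comp_eq_of_squares h3 h2

lemma homology_iso_relH (hDK : ∀ t, D t ≤ K t) (h : ∀ t σ, σ ∉ D t) (n : ℕ) :
    Nonempty (cxFunctor hK ⋙ SSet.homologyFunctor (ModuleCat.of k k) n ≅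
      arrowFunctor (inclNat hD hK hDK) ⋙ relH k n) := by
  have (t : T) := isIso_toRelH_of_isEmpty (k := k) ((arrowFunctor (inclNat hD hK hDK)).obj t)
    (fun m => ⟨fun x => h t _ x.2⟩) n
  exact ⟨NatIso.ofComponents (fun t => @asIso _ _ _ _ _ (this t)) fun {a b} i =>
    (toRelH (k := k) n).naturality ((arrowFunctor (inclNat hD hK hDK)).map i)⟩

end Complexes

/-! ### Assembly for the relative Delaunay–Čech complex. -/

section Main

variable (k : Type u) [Field k] {d : ℕ} {X₁ X₂ : Set (EuclideanSpace ℝ (Fin d))} {s ε : ℝ}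

lemma delaunayImage_le_relDelCech (t : Set.Ioi (0 : ℝ)) :
    delaunayImage X₁ X₂ s ≤ relDelCech X₁ X₂ s ε t := le_sup_left

/-- The relative homology of the relative Delaunay–Čech complex modulo the Delaunay complex. -/
theorem relDelCech_relH_iso (hX₁ : X₁.Finite) (hX₂ : X₂.Finite) (hs : 0 < s)
    (hε : IsAdmissible (liftedPair X₁ X₂ s) ε) (n : ℕ) :
    Nonempty (arrowFunctor (inclNat (monotone_const (c := delaunayImage X₁ X₂ s))
        (relDelCech X₁ X₂ s ε).monotone delaunayImage_le_relDelCech) ⋙ relH k n ≅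
      thickeningRelativeHomology k (Set.subset_union_left : X₁ ⊆ X₁ ∪ X₂) n) := by
  obtain ⟨e₁⟩ := relH_iso_thickening (X₁ := X₁) (X₂ := X₂) k hX₁ hX₂ hs hε.1 n
  obtain ⟨e₂⟩ := relH_iso_of_excision k (fun _ _ h => nerveOf_mono (monotone_cellRel₁ h))
    (fun _ _ h => nerveOf_mono (monotone_cellRel h)) (monotone_const (c := delaunayImage X₁ X₂ s))
    (relDelCech X₁ X₂ s ε).monotone (fun t => nerveOf_mono (cellRel₁_le (t : ℝ)))
    delaunayImage_le_relDelCech (fun t => nerveOf_cellRel₁_le_delaunayImage hε t)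
    (fun t => (dowkerNerve_liftedDissim hε t).ge.trans le_sup_right)
    (fun t σ hσ => hσ.imp id fun h => by rwa [← dowkerNerve_liftedDissim hε t])
    (fun t σ => mem_nerveOf_cellRel₁) n
  exact ⟨e₂.symm ≪≫ e₁⟩

end Main

end RelDelCech

end

theorem mainTheorem2 {k : Type*} [Field k] {d : ℕ}
    (X₁ X₂ : Set (EuclideanSpace ℝ (Fin d))) (_hX₁ : X₁.Finite) (_hX₂ : X₂.Finite)
    -- `s₁`, `s₂` exceed all filtration values of the alpha complexes of `X₁`, `X₂`
    (ε₁ ε₂ s₁ s₂ : ℝ)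
    (_hε₁ : RelDelCech.IsAdmissible X₁ ε₁) (_hε₂ : RelDelCech.IsAdmissible X₂ ε₂)
    (_hs₁ : ∀ σ ∈ RelDelCech.delaunayComplex X₁,
      RelDelCech.filtrationValue (RelDelCech.alphaComplex ε₁ X₁) σ < s₁)
    (_hs₂ : ∀ σ ∈ RelDelCech.delaunayComplex X₂,
      RelDelCech.filtrationValue (RelDelCech.alphaComplex ε₂ X₂) σ < s₂)
    (s : ℝ) (_hs0 : 0 < s) (_hs : max s₁ s₂ < s)
    (ε : ℝ) (_hε : RelDelCech.IsAdmissible (RelDelCech.liftedPair X₁ X₂ s) ε) :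
    (X₁.Nonempty → ∀ n : ℕ, Nonempty
      (RelDelCech.persistentReducedHomology k (RelDelCech.relDelCech X₁ X₂ s ε) n ≅
        RelDelCech.thickeningRelativeHomology k
          (Set.subset_union_left : X₁ ⊆ X₁ ∪ X₂) n)) ∧
    (X₁ = ∅ → ∀ n : ℕ, Nonempty
      (RelDelCech.persistentHomology k (RelDelCech.relDelCech X₁ X₂ s ε) n ≅
        RelDelCech.thickeningRelativeHomology k
          (Set.subset_union_left : X₁ ⊆ X₁ ∪ X₂) n)) := by
  constructor
  · intro hne n
    obtain ⟨e₁⟩ := RelDelCech.reduced_iso_relH k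
      (monotone_const (c := RelDelCech.delaunayImage X₁ X₂ s))
      (RelDelCech.relDelCech X₁ X₂ s ε).monotone RelDelCech.delaunayImage_le_relDelCech
      (fun _ => RelDelCech.hIso_terminal_delaunayImage k _hε₁ _hX₁ hne) n
    obtain ⟨e₂⟩ := RelDelCech.relDelCech_relH_iso k _hX₁ _hX₂ _hs0 _hε n
    exact ⟨e₁ ≪≫ e₂⟩
  · intro hempty n
    obtain ⟨e₁⟩ := RelDelCech.homology_iso_relH k
      (monotone_const (c := RelDelCech.delaunayImage X₁ X₂ s))
      (RelDelCech.relDelCech X₁ X₂ s ε).monotone RelDelCech.delaunayImage_le_relDelCech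
      (fun _ σ hσ => by
        obtain ⟨⟨z, hz⟩, p, hp⟩ := RelDelCech.mem_delaunayImage.1 hσ
        obtain ⟨x, -, -⟩ := hp z hz
        exact (hempty ▸ x.2 : x.1 ∈ (∅ : Set _)).elim) n
    obtain ⟨e₂⟩ := RelDelCech.relDelCech_relH_iso k _hX₁ _hX₂ _hs0 _hε n
    exact ⟨e₁ ≪≫ e₂⟩
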